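/- Fix integers $n\ge 0$ and $m\ge 0$. A point cluster of degree $m$ is a formal sum $Z=P_1+\dots+P_m$ of points $P_j\in\mathbb P^n(\mathbb C)$; for a linear subspace $L$, $\deg Z|_L$ is the number of $j$ with $P_j\in L$. $Z$ is stable if $(n+1)\deg Z|_L<(\dim L+1)\,m$ for every linear subspace $\emptyset\ne L\subsetneq\mathbb P^n$. A point cluster with scaling $\tilde Z$ over $Z$ is a choice of coordinate row vectors (again denoted $P_j$) for the points of $Z$, up to reordering and up to multiplying them by scalars whose product is $1$. Let $\mathcal H_{n,\mathbb C}$ (resp. $\mathcal H_{n,\mathbb R}$) be the space of positive definite Hermitian (resp. real symmetric) $(n+1)\times(n+1)$ matrices modulo scaling by positive reals; regarding real symmetric matrices as Hermitian ones gives a natural map $\mathcal H_{n,\mathbb R}\to\mathcal H_{n,\mathbb C}$. The group $\mathrm{SL}(n+1,\mathbb C)$ acts from the right on $\mathcal H_{n,\mathbb C}$ by $Q\cdot\gamma=\bar\gamma^{\top}Q\gamma$ and on clusters and on clusters with scaling through $P\cdot\gamma=P\gamma^{-\top}$ on row vectors; complex conjugation acts on all these objects coefficientwise. For $Q\in\mathcal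 H_{n,\mathbb C}$ put $$D(\tilde Z,Q)=\sum_{j=1}^m\log(\bar P_jQP_j^{\top})-\frac m{n+1}\log\det Q,\qquad \theta(\tilde Z)=\inf_{Q\in\mathcal H_{n,\mathbb C}}\exp D(\tilde Z,Q)\ \ge 0 .$$ For stable $Z$ and any $\tilde Z$ over $Z$, the function $D(\tilde Z,\cdot)$ has a unique critical point $z(Z)$ on $\mathcal H_{n,\mathbb C}$; it depends only on $Z$, and $D(\tilde Z,\cdot)$ attains its global minimum $\log\theta(\tilde Z)$ there. Moreover: 1. For every stable $Z$ and every $\gamma\in\mathrm{SL}(n+1,\mathbb C)$, the cluster $Z\cdot\gamma$ is stable and $z(Z\cdot\gamma)=z(Z)\cdot\gamma$. 2. For every stable $Z$, the cluster $\bar Z$ is stable and $z(\bar Z)=\overline{z(Z)}$. 3. If $Z$ is stable and $\bar Z=Z$, then $z(Z)$ is the image of a unique element of $\mathcal H_{n,\mathbb R}$. 4. For every point cluster with scaling $\tilde Z$ of degree $m$ (stable or not) and every $\gamma\in\mathrm{SL}(n+1,\mathbb C)$, $\theta(\tilde Z\cdot\gamma)=\theta(\tilde Z)$ and $\theta(\overline{\tilde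 Z})=\theta(\tilde Z)$. -/

import Mathlib

open scoped Matrix LinearAlgebra.Projectivization ComplexOrder

noncomputable section

namespace PointCluster

/-! ### Positive definite forms modulo positive scaling -/

/-- Positive definite Hermitian (for `𝕜 = ℂ`), respectively positive definite symmetric
(for `𝕜 = ℝ`), matrices of size `n + 1`. The matrix `A` represents the form
`x ↦ x̄ A xᵀ`. -/
abbrev PDMatrix (𝕜 : Type) [RCLike 𝕜] (n : ℕ) : Type :=
  {A : Matrix (Fin (n + 1)) (Fin (n + 1)) 𝕜 // A.PosDef}

/-- Two positive definite forms are identified when they differ by a positive real factor. -/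
def scalingSetoid (𝕜 : Type) [RCLike 𝕜] (n : ℕ) : Setoid (PDMatrix 𝕜 n) where
  r A B := ∃ c : ℝ, 0 < c ∧ B.1 = c • A.1
  iseqv :=
    { refl := fun A => ⟨1, one_pos, (one_smul ℝ A.1).symm⟩
      symm := by
        rintro A B ⟨c, hc, h⟩
        exact ⟨c⁻¹, inv_pos.2 hc, by rw [h, smul_smul, inv_mul_cancel₀ hc.ne', one_smul]⟩
      trans := by
        rintro A B C ⟨c, hc, h⟩ ⟨d, hd, h'⟩
        exact ⟨d * c, mul_pos hd hc, by rw [h', h, smul_smul]⟩ }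

/-- `FormSpace ℂ n` is the space `𝓗_{n,ℂ}` of positive definite Hermitian forms in `n + 1`
variables modulo positive scaling, and `FormSpace ℝ n` is the space `𝓗_{n,ℝ}` of positive
definite real quadratic forms in `n + 1` variables modulo positive scaling. -/
def FormSpace (𝕜 : Type) [RCLike 𝕜] (n : ℕ) : Type := Quotient (scalingSetoid 𝕜 n)

/-- The class of a positive definite matrix. -/
def FormSpace.mk {𝕜 : Type} [RCLike 𝕜] {n : ℕ} (A : PDMatrix 𝕜 n) : FormSpace 𝕜 n :=
  Quotient.mk (scalingSetoid 𝕜 n) A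

instance (𝕜 : Type) [RCLike 𝕜] (n : ℕ) : Nonempty (FormSpace 𝕜 n) :=
  ⟨FormSpace.mk ⟨1, Matrix.PosDef.one⟩⟩

open Classical in
/-- The class of a matrix that is positive definite (the value at all other matrices is
irrelevant: this is only used near positive definite Hermitian matrices). -/
def FormSpace.ofMatrix {𝕜 : Type} [RCLike 𝕜] {n : ℕ}
    (A : Matrix (Fin (n + 1)) (Fin (n + 1)) 𝕜) : FormSpace 𝕜 n :=
  if h : A.PosDef then FormSpace.mk ⟨A, h⟩ else FormSpace.mk ⟨1, Matrix.PosDef.one⟩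

theorem posDef_act {n : ℕ} (γ : Matrix.SpecialLinearGroup (Fin (n + 1)) ℂ)
    {A : Matrix (Fin (n + 1)) (Fin (n + 1)) ℂ} (hA : A.PosDef) :
    ((γ : Matrix (Fin (n + 1)) (Fin (n + 1)) ℂ)ᴴ * A * γ).PosDef := by
  refine hA.conjTranspose_mul_mul_same (Matrix.mulVec_injective_of_isUnit ?_)
  rw [Matrix.isUnit_iff_isUnit_det, γ.det_coe]
  exact isUnit_one

theorem posDef_conj {n : ℕ} {A : Matrix (Fin (n + 1)) (Fin (n + 1)) ℂ} (hA : A.PosDef) :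
    (A.map (starRingEnd ℂ)).PosDef := by
  have h : A.map (starRingEnd ℂ) = Aᵀ := by
    ext i j
    exact hA.isHermitian.apply j i
  rw [h]
  exact hA.transpose

theorem posDef_complexify {n : ℕ} {A : Matrix (Fin (n + 1)) (Fin (n + 1)) ℝ} (hA : A.PosDef) :
    (A.map (algebraMap ℝ ℂ)).PosDef := by
  have hsym : ∀ i j, A i j = A j i := fun i j => by simpa using hA.isHermitian.apply j i
  refine Matrix.PosDef.of_dotProduct_mulVec_pos ?_ ?_
  · ext i j
    simp [hsym i j]
  · intro x hx
    have key : star x ⬝ᵥ (A.map (algebraMap ℝ ℂ)) *ᵥ x =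
        (((fun i => (x i).re) ⬝ᵥ A *ᵥ (fun i => (x i).re) +
          (fun i => (x i).im) ⬝ᵥ A *ᵥ (fun i => (x i).im) : ℝ) : ℂ) := by
      apply Complex.ext
      · simp only [dotProduct, Matrix.mulVec, Finset.mul_sum, Complex.re_sum, Complex.ofReal_re,
          ← Finset.sum_add_distrib]
        refine Finset.sum_congr rfl fun i _ => Finset.sum_congr rfl fun j _ => ?_
        simp
      · simp only [dotProduct, Matrix.mulVec, Finset.mul_sum, Complex.im_sum, Complex.ofReal_im]
        have h1 : ∀ i j, (star x i * ((A.map (algebraMap ℝ ℂ)) i j * x j)).im =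
            A i j * ((x i).re * (x j).im) - A j i * ((x j).re * (x i).im) := by
          intro i j
          rw [hsym j i]
          simp
          ring
        simp only [h1, Finset.sum_sub_distrib]
        rw [sub_eq_zero]
        exact Finset.sum_comm
    rw [key]
    have hnn : ∀ y : Fin (n + 1) → ℝ, 0 ≤ y ⬝ᵥ A *ᵥ y := fun y => by
      simpa using hA.posSemidef.dotProduct_mulVec_nonneg y
    have hpos : ∀ y : Fin (n + 1) → ℝ, y ≠ 0 → 0 < y ⬝ᵥ A *ᵥ y := fun y hy => by
      simpa using hA.dotProduct_mulVec_pos hy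
    rw [Complex.zero_lt_real]
    by_cases hre : (fun i => (x i).re) = 0
    · refine add_pos_of_nonneg_of_pos (hnn _) (hpos _ fun him => hx ?_)
      funext i
      exact Complex.ext (congrFun hre i) (congrFun him i)
    · exact add_pos_of_pos_of_nonneg (hpos _ hre) (hnn _)

/-- The right action `Q ↦ Q · γ` of `SL(n+1, ℂ)` on `𝓗_{n,ℂ}`; on matrices it is
`A ↦ γ̄ᵀ A γ`, i.e. linear substitution of the variables. -/
def FormSpace.act {n : ℕ} (Q : FormSpace ℂ n)
    (γ : Matrix.SpecialLinearGroup (Fin (n + 1)) ℂ) : FormSpace ℂ n :=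
  Quotient.map' (s₁ := scalingSetoid ℂ n) (s₂ := scalingSetoid ℂ n)
    (fun A => ⟨(γ : Matrix (Fin (n + 1)) (Fin (n + 1)) ℂ)ᴴ * A.1 * γ, posDef_act γ A.2⟩)
    (by
      rintro A B ⟨c, hc, h⟩
      exact ⟨c, hc, by simp [h]⟩) Q

/-- Complex conjugation `Q ↦ Q̄` (of the coefficients) on `𝓗_{n,ℂ}`. -/
def FormSpace.conj {n : ℕ} (Q : FormSpace ℂ n) : FormSpace ℂ n :=
  Quotient.map' (s₁ := scalingSetoid ℂ n) (s₂ := scalingSetoid ℂ n)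
    (fun A => ⟨A.1.map (starRingEnd ℂ), posDef_conj A.2⟩)
    (by
      rintro A B ⟨c, hc, h⟩
      refine ⟨c, hc, Matrix.ext fun i j => ?_⟩
      simp [h]) Q

/-- The natural map `𝓗_{n,ℝ} → 𝓗_{n,ℂ}`, regarding a real symmetric matrix as a Hermitian one. -/
def FormSpace.complexify {n : ℕ} (Q : FormSpace ℝ n) : FormSpace ℂ n :=
  Quotient.map' (s₁ := scalingSetoid ℝ n) (s₂ := scalingSetoid ℂ n)
    (fun A => ⟨A.1.map (algebraMap ℝ ℂ), posDef_complexify A.2⟩)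
    (by
      rintro A B ⟨c, hc, h⟩
      refine ⟨c, hc, Matrix.ext fun i j => ?_⟩
      simp [h]) Q

/-- `Q` is a critical point of `f : 𝓗_{n,ℂ} → ℝ`: the function that `f` induces on the open cone
of positive definite matrices in the real vector space of Hermitian matrices has vanishing
derivative, in every Hermitian direction, at the matrices representing `Q`. -/
def IsCriticalPoint {n : ℕ} (f : FormSpace ℂ n → ℝ) (Q : FormSpace ℂ n) : Prop :=
  ∀ A : PDMatrix ℂ n, FormSpace.mk A = Q →
    ∀ B : Matrix (Fin (n + 1)) (Fin (n + 1)) ℂ, B.IsHermitian →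
      HasLineDerivAt ℝ (fun M => f (FormSpace.ofMatrix M)) 0 A.1 B

/-! ### Point clusters -/

/-- `ℙⁿ(ℂ)`; a point has row vectors of length `n + 1` as homogeneous coordinates. -/
abbrev ProjSpace (n : ℕ) : Type := ℙ ℂ (Fin (n + 1) → ℂ)

/-- The set `𝓩_m` of point clusters of degree `m`: unordered formal sums of `m` points of
`ℙⁿ(ℂ)`. -/
abbrev Cluster (n m : ℕ) : Type := Sym (ProjSpace n) m

open Classical in
/-- `deg Z|_L`, the number of points (with multiplicity) of `Z` on the linear subspace `L` of
`ℙⁿ`. Such an `L` is given by a vector subspace `W` of `ℂⁿ⁺¹`; thus `dim L + 1 = finrank W`, and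
`∅ ≠ L ⊊ ℙⁿ` means `W ≠ ⊥` and `W ≠ ⊤`. -/
def Cluster.degOn {n m : ℕ} (Z : Cluster n m) (W : Submodule ℂ (Fin (n + 1) → ℂ)) : ℕ :=
  Multiset.card ((Z : Multiset (ProjSpace n)).filter (fun P => P.submodule ≤ W))

/-- `Z` is stable if `(n + 1) deg Z|_L < (dim L + 1) deg Z` for all linear subspaces
`∅ ≠ L ⊊ ℙⁿ`. -/
def Cluster.IsStable {n m : ℕ} (Z : Cluster n m) : Prop :=
  ∀ W : Submodule ℂ (Fin (n + 1) → ℂ), W ≠ ⊥ → W ≠ ⊤ →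
    (n + 1) * Z.degOn W < Module.finrank ℂ W * m

/-- The right action of `SL(n+1, ℂ)` on coordinate row vectors, `x ↦ x γ^{-⊤}`. -/
def coordAct {n : ℕ} (γ : Matrix.SpecialLinearGroup (Fin (n + 1)) ℂ) :
    (Fin (n + 1) → ℂ) →ₗ[ℂ] (Fin (n + 1) → ℂ) :=
  Matrix.vecMulLinear ((γ⁻¹ : Matrix.SpecialLinearGroup (Fin (n + 1)) ℂ) :
    Matrix (Fin (n + 1)) (Fin (n + 1)) ℂ)ᵀ

theorem coordAct_injective {n : ℕ} (γ : Matrix.SpecialLinearGroup (Fin (n + 1)) ℂ) :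
    Function.Injective (coordAct γ) := by
  refine Matrix.vecMul_injective_of_isUnit ?_
  rw [Matrix.isUnit_iff_isUnit_det, Matrix.det_transpose, Matrix.SpecialLinearGroup.det_coe]
  exact isUnit_one

/-- Complex conjugation on coordinate vectors, as a conjugate-linear map. -/
def coordConj (n : ℕ) : (Fin (n + 1) → ℂ) →ₛₗ[starRingEnd ℂ] (Fin (n + 1) → ℂ) where
  toFun x := fun i => starRingEnd ℂ (x i)
  map_add' x y := by ext i; simp
  map_smul' c x := by ext i; simp

theorem coordConj_injective (n : ℕ) : Function.Injective (coordConj n) := by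
  intro x y h
  funext i
  exact (starRingEnd ℂ).injective (congrFun h i)

/-- The right action `Z ↦ Z · γ` of `SL(n+1, ℂ)` on point clusters. -/
def Cluster.act {n m : ℕ} (Z : Cluster n m) (γ : Matrix.SpecialLinearGroup (Fin (n + 1)) ℂ) :
    Cluster n m :=
  Sym.map (Projectivization.map (coordAct γ) (coordAct_injective γ)) Z

/-- Complex conjugation `Z ↦ Z̄` on point clusters. -/
def Cluster.conj {n m : ℕ} (Z : Cluster n m) : Cluster n m :=
  Sym.map (Projectivization.map (coordConj n) (coordConj_injective n)) Z

/-! ### Point clusters with scaling -/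

/-- A choice of coordinate vectors for `m` points. -/
abbrev CoordTuple (n m : ℕ) : Type := Fin m → {v : Fin (n + 1) → ℂ // v ≠ 0}

/-- Two tuples of coordinate vectors represent the same cluster with scaling if they agree up to
reordering and up to multiplying the vectors by scalars whose product is `1`. -/
def scaledSetoid (n m : ℕ) : Setoid (CoordTuple n m) where
  r v w := ∃ (σ : Equiv.Perm (Fin m)) (c : Fin m → ℂ), ∏ j, c j = 1 ∧
    ∀ j, (w (σ j)).1 = c j • (v j).1
  iseqv :=
    { refl := fun v => ⟨1, 1, by simp, by simp⟩
      symm := by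
        rintro v w ⟨σ, c, hc, h⟩
        have hc0 : ∀ j, c j ≠ 0 := by
          intro j hj
          rw [Finset.prod_eq_zero (Finset.mem_univ j) hj] at hc
          exact zero_ne_one hc
        refine ⟨σ⁻¹, fun j => (c (σ⁻¹ j))⁻¹, ?_, ?_⟩
        · rw [Equiv.prod_comp σ⁻¹ (fun j => (c j)⁻¹), Finset.prod_inv_distrib, hc, inv_one]
        · intro j
          have := h (σ⁻¹ j)
          rw [show σ (σ⁻¹ j) = j from σ.apply_symm_apply j] at this
          rw [this, smul_smul, inv_mul_cancel₀ (hc0 _), one_smul]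
      trans := by
        rintro u v w ⟨σ, c, hc, h⟩ ⟨τ, d, hd, h'⟩
        refine ⟨τ * σ, fun j => d (σ j) * c j, ?_, ?_⟩
        · rw [Finset.prod_mul_distrib, Equiv.prod_comp σ d, hc, hd, one_mul]
        · intro j
          rw [Equiv.Perm.mul_apply, h', h, smul_smul] }

/-- The set `𝓩̃_m` of point clusters of degree `m` with scaling. -/
def ScaledCluster (n m : ℕ) : Type := Quotient (scaledSetoid n m)

/-- The natural map `𝓩̃_m → 𝓩_m`. -/
def ScaledCluster.toCluster {n m : ℕ} (Z : ScaledCluster n m) : Cluster n m :=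
  Quotient.lift (s := scaledSetoid n m)
    (fun v => (⟨(Finset.univ : Finset (Fin m)).val.map (fun j => Projectivization.mk' ℂ (v j)),
      by simp⟩ : Cluster n m))
    (by
      rintro v w ⟨σ, c, hc, h⟩
      have hc0 : ∀ j, c j ≠ 0 := by
        intro j hj
        rw [Finset.prod_eq_zero (Finset.mem_univ j) hj] at hc
        exact zero_ne_one hc
      have hvw : ∀ j, Projectivization.mk' ℂ (v j) = Projectivization.mk' ℂ (w (σ j)) := by
        intro j
        rw [Projectivization.mk'_eq_mk, Projectivization.mk'_eq_mk,
          Projectivization.mk_eq_mk_iff']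
        exact ⟨(c j)⁻¹, by rw [h, smul_smul, inv_mul_cancel₀ (hc0 j), one_smul]⟩
      apply Subtype.ext
      change Multiset.map (fun j => Projectivization.mk' ℂ (v j)) Finset.univ.val =
        Multiset.map (fun j => Projectivization.mk' ℂ (w j)) Finset.univ.val
      rw [Multiset.map_congr rfl (fun j _ => hvw j)]
      have hσ : (Finset.univ : Finset (Fin m)).val.map σ = Finset.univ.val := by
        simp
      conv_rhs => rw [← hσ, Multiset.map_map]
      rfl) Z

/-- The right action `Z̃ ↦ Z̃ · γ` of `SL(n+1, ℂ)` on clusters with scaling. -/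
def ScaledCluster.act {n m : ℕ} (Z : ScaledCluster n m)
    (γ : Matrix.SpecialLinearGroup (Fin (n + 1)) ℂ) : ScaledCluster n m :=
  Quotient.map' (s₁ := scaledSetoid n m) (s₂ := scaledSetoid n m)
    (fun v j => ⟨coordAct γ (v j).1,
      (map_ne_zero_iff (coordAct γ) (coordAct_injective γ)).2 (v j).2⟩)
    (by
      rintro v w ⟨σ, c, hc, h⟩
      exact ⟨σ, c, hc, fun j => by simp [h]⟩) Z

/-- Complex conjugation on clusters with scaling. -/
def ScaledCluster.conj {n m : ℕ} (Z : ScaledCluster n m) : ScaledCluster n m :=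
  Quotient.map' (s₁ := scaledSetoid n m) (s₂ := scaledSetoid n m)
    (fun v j => ⟨coordConj n (v j).1,
      (map_ne_zero_iff (coordConj n) (coordConj_injective n)).2 (v j).2⟩)
    (by
      rintro v w ⟨σ, c, hc, h⟩
      refine ⟨σ, fun j => starRingEnd ℂ (c j), ?_, fun j => by simp [h]⟩
      rw [← map_prod, hc, map_one]) Z

/-! ### The distance function, the covariant `z` and the function `θ` -/

/-- `P̄ A Pᵀ`, which is a (positive) real number for positive definite `A` and `P ≠ 0`. -/
def hermValue {n : ℕ} (A : Matrix (Fin (n + 1)) (Fin (n + 1)) ℂ) (P : Fin (n + 1) → ℂ) : ℝ :=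
  (star P ⬝ᵥ A *ᵥ P).re

/-- The formula `∑ⱼ log (P̄ⱼ A Pⱼᵀ) - m / (n + 1) * log (det A)` on representatives. -/
def distOn {n m : ℕ} (v : CoordTuple n m) (A : PDMatrix ℂ n) : ℝ :=
  ∑ j, Real.log (hermValue A.1 (v j).1) - (m : ℝ) / (n + 1) * Real.log A.1.det.re

theorem hermValue_pos {n : ℕ} {A : Matrix (Fin (n + 1)) (Fin (n + 1)) ℂ} (hA : A.PosDef)
    {P : Fin (n + 1) → ℂ} (hP : P ≠ 0) : 0 < hermValue A P :=
  (Complex.pos_iff.1 (hA.dotProduct_mulVec_pos hP)).1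

theorem hermValue_smul_right {n : ℕ} (A : Matrix (Fin (n + 1)) (Fin (n + 1)) ℂ)
    (c : ℂ) (P : Fin (n + 1) → ℂ) : hermValue A (c • P) = ‖c‖ ^ 2 * hermValue A P := by
  have h : star (c • P) ⬝ᵥ A *ᵥ (c • P) = ((‖c‖ ^ 2 : ℝ) : ℂ) * (star P ⬝ᵥ A *ᵥ P) := by
    rw [star_smul, Matrix.mulVec_smul, smul_dotProduct, dotProduct_smul, smul_smul, smul_eq_mul]
    congr 1
    rw [Complex.star_def, Complex.conj_mul']
    push_cast
    rfl
  rw [hermValue, h, Complex.re_ofReal_mul]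
  rfl

theorem hermValue_smul_left {n : ℕ} (A : Matrix (Fin (n + 1)) (Fin (n + 1)) ℂ)
    (c : ℝ) (P : Fin (n + 1) → ℂ) : hermValue (c • A) P = c * hermValue A P := by
  simp [hermValue, Matrix.smul_mulVec]

theorem distOn_scaled {n m : ℕ} {v w : CoordTuple n m} (h : (scaledSetoid n m).r v w)
    (A : PDMatrix ℂ n) : distOn v A = distOn w A := by
  obtain ⟨σ, c, hc, h⟩ := h
  have hc0 : ∀ j, c j ≠ 0 := by
    intro j hj
    rw [Finset.prod_eq_zero (Finset.mem_univ j) hj] at hc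
    exact zero_ne_one hc
  have hsum : ∑ j, Real.log (hermValue A.1 (w j).1) =
      ∑ j, Real.log (hermValue A.1 (v j).1) := by
    rw [← Equiv.sum_comp σ (fun j => Real.log (hermValue A.1 (w j).1))]
    have h1 : ∀ j, Real.log (hermValue A.1 (w (σ j)).1) =
        Real.log (‖c j‖ ^ 2) + Real.log (hermValue A.1 (v j).1) := by
      intro j
      rw [h, hermValue_smul_right, Real.log_mul (pow_ne_zero 2 (norm_ne_zero_iff.2 (hc0 j)))
        (hermValue_pos A.2 (v j).2).ne']
    simp only [h1, Finset.sum_add_distrib]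
    rw [← Real.log_prod (fun j _ => pow_ne_zero 2 (norm_ne_zero_iff.2 (hc0 j))),
      Finset.prod_pow, ← norm_prod, hc]
    simp
  rw [distOn, distOn, hsum]

theorem distOn_scaling {n m : ℕ} (v : CoordTuple n m) {A B : PDMatrix ℂ n}
    (h : (scalingSetoid ℂ n).r A B) : distOn v A = distOn v B := by
  obtain ⟨c, hc, h⟩ := h
  have hdet : B.1.det.re = c ^ (n + 1) * A.1.det.re := by
    have h2 : B.1 = (c : ℂ) • A.1 := by
      rw [h]
      ext i j
      simp
    rw [h2, Matrix.det_smul, Fintype.card_fin, ← Complex.ofReal_pow, Complex.re_ofReal_mul]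
  have hdA : A.1.det.re ≠ 0 := (Complex.pos_iff.1 A.2.det_pos).1.ne'
  have h1 : ∀ j, Real.log (hermValue B.1 (v j).1) =
      Real.log c + Real.log (hermValue A.1 (v j).1) := by
    intro j
    rw [h, hermValue_smul_left, Real.log_mul hc.ne' (hermValue_pos A.2 (v j).2).ne']
  have hn : (n : ℝ) + 1 ≠ 0 := by positivity
  rw [distOn, distOn, hdet, Real.log_mul (pow_ne_zero _ hc.ne') hdA, Real.log_pow]
  simp only [h1, Finset.sum_add_distrib, Finset.sum_const, Finset.card_univ, Fintype.card_fin,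
    nsmul_eq_mul]
  push_cast
  field_simp
  ring

/-- The distance function `D(Z̃, Q)`. -/
def clusterDist {n m : ℕ} (Z : ScaledCluster n m) (Q : FormSpace ℂ n) : ℝ :=
  Quotient.lift₂ (s₁ := scaledSetoid n m) (s₂ := scalingSetoid ℂ n) distOn
    (fun _ A w _ h h' => (distOn_scaled h A).trans (distOn_scaling w h')) Z Q

/-- The covariant: `z(Z)` is the critical point of `D(Z̃, ·)`, for `Z̃` any cluster with scaling
above `Z`. For stable `Z` it exists and is unique; for other `Z` the value is irrelevant. -/
def z {n m : ℕ} (Z : Cluster n m) : FormSpace ℂ n :=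
  Classical.epsilon fun Q => ∀ Zt : ScaledCluster n m, Zt.toCluster = Z →
    IsCriticalPoint (clusterDist Zt) Q

/-- `θ(Z̃) = inf_Q exp (D(Z̃, Q))`, the infimum being over `𝓗_{n,ℂ}`. -/
def theta {n m : ℕ} (Z : ScaledCluster n m) : ℝ :=
  ⨅ Q : FormSpace ℂ n, Real.exp (clusterDist Z Q)

end PointCluster

end

/-! The distance function is geodesically convex. Simultaneous diagonalization joins any two
positive definite forms by a curve `Sᴴ diag(dᵢᵗ) S`. Along it, each `log (P̄ⱼ Q Pⱼᵀ)` is the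
logarithm of a positive sum of exponentials in `t`, hence convex, while the `log det` term is
affine. Jensen's inequality (`sum_mul_log_le_log_sum`) compares the tangent at `t = 0` with the
value at `t = 1`, so every critical point is a global minimum, stable or not. If two minima coexist,
equality in Jensen makes every point vector an eigenvector of one diagonalizable map. For a stable
cluster that map must be scalar, since the strict stability inequalities of its eigenspaces would
add up to `(n + 1) m < (n + 1) m` (`exists_const_of_isStable`). The two forms then agree modulo
scaling.

Existence is coercivity. Write a form as `Uᴴ diag(d) U` with `U` unitary and `d` increasing.
Compactness of the unitary group makes stability uniform in `U`: there is one threshold below which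
a coordinate may be treated as zero. Abel summation over the flag of coordinate subspaces then
bounds the distance below by a constant plus `(log d_max - log d_min) / (n + 1)`
(`exists_le_distOn`). After normalizing the least eigenvalue to 1, the infimum is attained on a
compact set.

Changing the scaling only adds a constant to the distance, so `z` depends on the cluster alone. The
distance is unchanged when the group, or conjugation, acts on both arguments. Equivariance of `z`
follows from uniqueness of the minimum, and invariance of `theta` from reindexing the infimum. For a
real cluster `z` is fixed by conjugation, and a fixed class has a real representative. -/

namespace PointCluster

/-! ### Diagonal forms in a given basis -/

/-- The Hermitian form with matrix `Sᴴ diag(d) S`. -/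
def diagForm {n : ℕ} (S : Matrix (Fin (n + 1)) (Fin (n + 1)) ℂ) (d : Fin (n + 1) → ℝ) :
    Matrix (Fin (n + 1)) (Fin (n + 1)) ℂ :=
  Sᴴ * Matrix.diagonal (fun i => (d i : ℂ)) * S

theorem diagForm_one {n : ℕ} (S : Matrix (Fin (n + 1)) (Fin (n + 1)) ℂ) :
    diagForm S 1 = Sᴴ * S := by
  simp [diagForm]

theorem diagForm_add_smul {n : ℕ} (S : Matrix (Fin (n + 1)) (Fin (n + 1)) ℂ)
    (d e : Fin (n + 1) → ℝ) (t : ℝ) :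
    diagForm S d + t • diagForm S e = diagForm S (d + t • e) := by
  have h : Matrix.diagonal (fun i => (((d + t • e) i : ℝ) : ℂ)) =
      Matrix.diagonal (fun i => (d i : ℂ)) + t • Matrix.diagonal (fun i => (e i : ℂ)) := by
    rw [← Matrix.diagonal_smul, Matrix.diagonal_add]
    congr 1
    funext i
    simp
  rw [diagForm, diagForm, diagForm, h, mul_add, add_mul, Matrix.mul_smul, Matrix.smul_mul]

theorem smul_diagForm {n : ℕ} (S : Matrix (Fin (n + 1)) (Fin (n + 1)) ℂ)
    (d : Fin (n + 1) → ℝ) (t : ℝ) : t • diagForm S d = diagForm S (t • d) := by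
  have h := diagForm_add_smul S 0 d t
  have h0 : diagForm S 0 = 0 := by simp [diagForm]
  rwa [h0, zero_add, zero_add] at h

theorem isHermitian_diagForm {n : ℕ} (S : Matrix (Fin (n + 1)) (Fin (n + 1)) ℂ)
    (d : Fin (n + 1) → ℝ) : (diagForm S d).IsHermitian := by
  refine Matrix.isHermitian_conjTranspose_mul_mul S ?_
  refine Matrix.isHermitian_diagonal_iff.2 fun i => ?_
  simp [IsSelfAdjoint]

theorem posDef_diagForm {n : ℕ} {S : Matrix (Fin (n + 1)) (Fin (n + 1)) ℂ} (hS : S.det ≠ 0)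
    {d : Fin (n + 1) → ℝ} (hd : ∀ i, 0 < d i) : (diagForm S d).PosDef := by
  refine (Matrix.PosDef.diagonal fun i => ?_).conjTranspose_mul_mul_same
    (Matrix.mulVec_injective_of_isUnit ((Matrix.isUnit_iff_isUnit_det S).2 hS.isUnit))
  exact Complex.zero_lt_real.2 (hd i)

theorem hermValue_diagForm {n : ℕ} (S : Matrix (Fin (n + 1)) (Fin (n + 1)) ℂ)
    (d : Fin (n + 1) → ℝ) (P : Fin (n + 1) → ℂ) :
    hermValue (diagForm S d) P = ∑ i, d i * ‖(S *ᵥ P) i‖ ^ 2 := by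
  have h : star P ⬝ᵥ diagForm S d *ᵥ P = ((∑ i, d i * ‖(S *ᵥ P) i‖ ^ 2 : ℝ) : ℂ) := by
    rw [diagForm, ← Matrix.mulVec_mulVec, ← Matrix.mulVec_mulVec, Matrix.dotProduct_mulVec,
      ← Matrix.star_mulVec, dotProduct]
    push_cast
    refine Finset.sum_congr rfl fun i _ => ?_
    rw [Matrix.mulVec_diagonal, Pi.star_apply, Complex.star_def, ← Complex.conj_mul']
    ring
  rw [hermValue, h, Complex.ofReal_re]

theorem det_diagForm {n : ℕ} (S : Matrix (Fin (n + 1)) (Fin (n + 1)) ℂ)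
    (d : Fin (n + 1) → ℝ) : (diagForm S d).det.re = ‖S.det‖ ^ 2 * ∏ i, d i := by
  have h : (diagForm S d).det = ((‖S.det‖ ^ 2 * ∏ i, d i : ℝ) : ℂ) := by
    rw [diagForm, Matrix.det_mul, Matrix.det_mul, Matrix.det_diagonal,
      Matrix.det_conjTranspose]
    push_cast
    rw [← Complex.conj_mul', Complex.star_def]
    ring
  rw [h, Complex.ofReal_re]

/-- The spectral theorem, with the eigenvector rows permuted to put the eigenvalues in increasing
order. The order is what later allows summation along a flag. -/
theorem exists_unitary_diagForm {n : ℕ} {A : Matrix (Fin (n + 1)) (Fin (n + 1)) ℂ}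
    (hA : A.IsHermitian) :
    ∃ U ∈ Matrix.unitaryGroup (Fin (n + 1)) ℂ, ∃ d : Fin (n + 1) → ℝ,
      Monotone d ∧ A = diagForm U d := by
  let V : Matrix (Fin (n + 1)) (Fin (n + 1)) ℂ := hA.eigenvectorUnitary
  have hV : V * Vᴴ = 1 := Matrix.mem_unitaryGroup_iff.1 hA.eigenvectorUnitary.2
  let σ := Tuple.sort hA.eigenvalues
  refine ⟨Vᴴ.submatrix σ id, ?_, hA.eigenvalues ∘ σ, Tuple.monotone_sort _, ?_⟩
  · rw [Matrix.mem_unitaryGroup_iff', Matrix.star_eq_conjTranspose,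
      Matrix.conjTranspose_submatrix, Matrix.submatrix_mul_equiv, Matrix.conjTranspose_conjTranspose, hV]
    simp
  · have h1 : Matrix.diagonal (fun i => (((hA.eigenvalues ∘ σ) i : ℝ) : ℂ)) =
        (Matrix.diagonal (fun i => (hA.eigenvalues i : ℂ))).submatrix σ σ := by
      rw [Matrix.submatrix_diagonal_equiv]
      rfl
    rw [diagForm, h1, Matrix.conjTranspose_submatrix, Matrix.submatrix_mul_equiv,
      Matrix.submatrix_mul_equiv, Matrix.conjTranspose_conjTranspose, Matrix.submatrix_id_id]
    conv_lhs => rw [hA.spectral_theorem, Unitary.conjStarAlgAut_apply]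
    rfl

theorem det_ne_zero_of_mem_unitaryGroup {n : ℕ} {U : Matrix (Fin (n + 1)) (Fin (n + 1)) ℂ}
    (hU : U ∈ Matrix.unitaryGroup (Fin (n + 1)) ℂ) : U.det ≠ 0 := by
  intro h
  have h1 := congrArg Matrix.det (Matrix.mem_unitaryGroup_iff.1 hU)
  rw [Matrix.det_mul, h, zero_mul, Matrix.det_one] at h1
  exact zero_ne_one h1

theorem inv_mulVec_single_ne_zero {n : ℕ} {S : Matrix (Fin (n + 1)) (Fin (n + 1)) ℂ}
    (hS : S.det ≠ 0) (i : Fin (n + 1)) : S⁻¹ *ᵥ Pi.single i 1 ≠ 0 := by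
  intro h
  have h2 := congrArg (S *ᵥ ·) h
  simp only [Matrix.mulVec_mulVec, Matrix.mul_nonsing_inv S hS.isUnit, Matrix.one_mulVec,
    Matrix.mulVec_zero] at h2
  simp at h2

/-- The form takes the value `d i` at the basis vector whose `S`-coordinates are those of the `i`-th
unit vector. -/
theorem pos_of_posDef_diagForm {n : ℕ} {S : Matrix (Fin (n + 1)) (Fin (n + 1)) ℂ}
    (hS : S.det ≠ 0) {d : Fin (n + 1) → ℝ} (h : (diagForm S d).PosDef) (i : Fin (n + 1)) :
    0 < d i := by
  have h3 := hermValue_pos h (inv_mulVec_single_ne_zero hS i)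
  rw [hermValue_diagForm, Matrix.mulVec_mulVec, Matrix.mul_nonsing_inv S hS.isUnit,
    Matrix.one_mulVec, Finset.sum_eq_single i] at h3
  · simpa using h3
  · intro j _ hj
    simp [hj]
  · simp

/-- Simultaneous diagonalization of a positive definite form and a Hermitian form. -/
theorem exists_simultaneous_diagForm {n : ℕ} {A B : Matrix (Fin (n + 1)) (Fin (n + 1)) ℂ}
    (hA : A.PosDef) (hB : B.IsHermitian) :
    ∃ S : Matrix (Fin (n + 1)) (Fin (n + 1)) ℂ, S.det ≠ 0 ∧ ∃ d : Fin (n + 1) → ℝ,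
      A = diagForm S 1 ∧ B = diagForm S d := by
  obtain ⟨U, hU, d, -, rfl⟩ := exists_unitary_diagForm hA.isHermitian
  have hd := pos_of_posDef_diagForm (det_ne_zero_of_mem_unitaryGroup hU) hA
  -- `T` is a square root of the first form, which becomes `Tᴴ T`. A unitary change of basis `V * T`
  -- preserves this, leaving `V` free to diagonalize the second form transported by `T⁻¹`.
  let T : Matrix (Fin (n + 1)) (Fin (n + 1)) ℂ :=
    Matrix.diagonal (fun i => ((Real.sqrt (d i) : ℝ) : ℂ)) * U
  have hT : T.det ≠ 0 := by
    rw [Matrix.det_mul, Matrix.det_diagonal]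
    refine mul_ne_zero (Finset.prod_ne_zero_iff.2 fun i _ => ?_)
      (det_ne_zero_of_mem_unitaryGroup hU)
    exact Complex.ofReal_ne_zero.2 (Real.sqrt_pos.2 (hd i)).ne'
  have hTT : diagForm U d = Tᴴ * T := by
    have h : (Matrix.diagonal (fun i => ((Real.sqrt (d i) : ℝ) : ℂ)))ᴴ *
        Matrix.diagonal (fun i => ((Real.sqrt (d i) : ℝ) : ℂ)) =
        Matrix.diagonal (fun i => (d i : ℂ)) := by
      rw [Matrix.diagonal_conjTranspose, Matrix.diagonal_mul_diagonal]
      congr 1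
      funext i
      rw [Pi.star_apply, Complex.star_def, Complex.conj_ofReal, ← Complex.ofReal_mul,
        Real.mul_self_sqrt (hd i).le]
    simp only [T]
    rw [Matrix.conjTranspose_mul, diagForm, ← h]
    simp only [Matrix.mul_assoc]
  have hTu : IsUnit T.det := hT.isUnit
  obtain ⟨V, hV, e, -, hVe⟩ :=
    exists_unitary_diagForm (Matrix.isHermitian_conjTranspose_mul_mul T⁻¹ hB)
  have hVV : Vᴴ * V = 1 := Matrix.mem_unitaryGroup_iff'.1 hV
  refine ⟨V * T, ?_, e, ?_, ?_⟩
  · rw [Matrix.det_mul]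
    exact mul_ne_zero (det_ne_zero_of_mem_unitaryGroup hV) hT
  · rw [diagForm_one, hTT, Matrix.conjTranspose_mul V T, Matrix.mul_assoc, ← Matrix.mul_assoc Vᴴ,
      hVV, Matrix.one_mul]
  · have h1 : diagForm (V * T) e = Tᴴ * diagForm V e * T := by
      simp only [diagForm, Matrix.conjTranspose_mul, Matrix.mul_assoc]
    have h2 : Tᴴ * (T⁻¹)ᴴ = 1 := by
      rw [← Matrix.conjTranspose_mul, Matrix.nonsing_inv_mul T hTu, Matrix.conjTranspose_one]
    rw [h1, ← hVe]
    calc B = (Tᴴ * (T⁻¹)ᴴ) * B * (T⁻¹ * T) := by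
          rw [h2, Matrix.nonsing_inv_mul T hTu, Matrix.one_mul, Matrix.mul_one]
      _ = _ := by simp only [Matrix.mul_assoc]

/-! ### The distance function in diagonal coordinates -/

theorem sum_norm_sq_mulVec_pos {n : ℕ} {S : Matrix (Fin (n + 1)) (Fin (n + 1)) ℂ}
    (hS : S.det ≠ 0) {d : Fin (n + 1) → ℝ} (hd : ∀ i, 0 < d i) {P : Fin (n + 1) → ℂ}
    (hP : P ≠ 0) : 0 < ∑ i, d i * ‖(S *ᵥ P) i‖ ^ 2 := by
  rw [← hermValue_diagForm]
  exact hermValue_pos (posDef_diagForm hS hd) hP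

theorem distOn_diagForm {n m : ℕ} (v : CoordTuple n m)
    {S : Matrix (Fin (n + 1)) (Fin (n + 1)) ℂ} (hS : S.det ≠ 0) {d : Fin (n + 1) → ℝ}
    (hd : ∀ i, 0 < d i) :
    distOn v ⟨diagForm S d, posDef_diagForm hS hd⟩ =
      ∑ j, Real.log (∑ i, d i * ‖(S *ᵥ (v j).1) i‖ ^ 2) -
        (m : ℝ) / (n + 1) * (Real.log (‖S.det‖ ^ 2) + ∑ i, Real.log (d i)) := by
  simp only [distOn, hermValue_diagForm]
  rw [det_diagForm, Real.log_mul (pow_ne_zero 2 (norm_ne_zero_iff.2 hS))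
    (Finset.prod_ne_zero_iff.2 fun i _ => (hd i).ne'), Real.log_prod fun i _ => (hd i).ne']

theorem ofMatrix_of_posDef {n : ℕ} {A : Matrix (Fin (n + 1)) (Fin (n + 1)) ℂ} (hA : A.PosDef) :
    FormSpace.ofMatrix A = FormSpace.mk ⟨A, hA⟩ :=
  dif_pos hA

/-- The cluster with scaling represented by a tuple of coordinate vectors. -/
def ScaledCluster.mk {n m : ℕ} (v : CoordTuple n m) : ScaledCluster n m :=
  Quotient.mk (scaledSetoid n m) v

theorem clusterDist_mk {n m : ℕ} (v : CoordTuple n m) (A : PDMatrix ℂ n) :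
    clusterDist (ScaledCluster.mk v) (FormSpace.mk A) = distOn v A :=
  rfl

/-- The derivative of the distance function at `SᴴS` in the direction `Sᴴ diag(d) S`. -/
theorem hasDerivAt_clusterDist {n m : ℕ} (v : CoordTuple n m)
    {S : Matrix (Fin (n + 1)) (Fin (n + 1)) ℂ} (hS : S.det ≠ 0) (d : Fin (n + 1) → ℝ) :
    HasDerivAt (fun t : ℝ => clusterDist (ScaledCluster.mk v)
        (FormSpace.ofMatrix (diagForm S 1 + t • diagForm S d)))
      (∑ j, (∑ i, d i * ‖(S *ᵥ (v j).1) i‖ ^ 2) / (∑ i, ‖(S *ᵥ (v j).1) i‖ ^ 2) -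
        (m : ℝ) / (n + 1) * ∑ i, d i) 0 := by
  have hlin : ∀ i, HasDerivAt (fun t : ℝ => 1 + t * d i) (d i) 0 := fun i => by
    simpa using ((hasDerivAt_id (0 : ℝ)).mul_const (d i)).const_add 1
  have hmain : HasDerivAt (fun t : ℝ =>
      ∑ j, Real.log (∑ i, (1 + t * d i) * ‖(S *ᵥ (v j).1) i‖ ^ 2) -
        (m : ℝ) / (n + 1) * (Real.log (‖S.det‖ ^ 2) + ∑ i, Real.log (1 + t * d i)))
      (∑ j, (∑ i, d i * ‖(S *ᵥ (v j).1) i‖ ^ 2) / (∑ i, ‖(S *ᵥ (v j).1) i‖ ^ 2) -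
        (m : ℝ) / (n + 1) * ∑ i, d i) 0 := by
    refine HasDerivAt.sub (HasDerivAt.fun_sum fun j _ => ?_)
      (HasDerivAt.const_mul _ (HasDerivAt.const_add _ (HasDerivAt.fun_sum fun i _ => ?_)))
    · have h1 : HasDerivAt (fun t : ℝ => ∑ i, (1 + t * d i) * ‖(S *ᵥ (v j).1) i‖ ^ 2)
          (∑ i, d i * ‖(S *ᵥ (v j).1) i‖ ^ 2) 0 :=
        HasDerivAt.fun_sum fun i _ => (hlin i).mul_const _
      have h2 := sum_norm_sq_mulVec_pos hS (d := 1) (fun _ => one_pos) (v j).2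
      have h3 := h1.log (by simpa using h2.ne')
      simpa using h3
    · simpa using (hlin i).log (by simp)
  refine hmain.congr_of_eventuallyEq ?_
  -- `FormSpace.ofMatrix` takes a default value off the positive definite cone, so the explicit
  -- formula is available only for small `t`.
  have hev : ∀ᶠ t in nhds (0 : ℝ), ∀ i, 0 < 1 + t * d i := by
    rw [Filter.eventually_all]
    intro i
    exact (hlin i).continuousAt.eventually_const_lt (by simp)
  filter_upwards [hev] with t ht
  have hd : ∀ i, 0 < ((1 : Fin (n + 1) → ℝ) + t • d) i := ht
  rw [diagForm_add_smul, ofMatrix_of_posDef (posDef_diagForm hS hd), clusterDist_mk,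
    distOn_diagForm v hS hd]
  simp

/-! ### Stability in coordinates -/

open Classical in
theorem degOn_toCluster_mk {n m : ℕ} (v : CoordTuple n m)
    (W : Submodule ℂ (Fin (n + 1) → ℂ)) :
    (ScaledCluster.mk v).toCluster.degOn W =
      (Finset.univ.filter fun j => (v j).1 ∈ W).card := by
  have h : ∀ j, (Projectivization.mk' ℂ (v j)).submodule ≤ W ↔ (v j).1 ∈ W := fun j => by
    rw [Projectivization.mk'_eq_mk, Projectivization.submodule_mk,
      Submodule.span_singleton_le_iff_mem]
  change Multiset.card (Multiset.filter _
    (Multiset.map (fun j => Projectivization.mk' ℂ (v j)) Finset.univ.val)) = _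
  rw [Multiset.filter_map, Multiset.card_map, Finset.card_def, Finset.filter_val]
  congr 1
  exact Multiset.filter_congr fun j _ => h j

/-- The vectors whose coordinates in the basis given by `S` vanish outside `T`. -/
def coordSubspace {n : ℕ} (S : Matrix (Fin (n + 1)) (Fin (n + 1)) ℂ)
    (T : Finset (Fin (n + 1))) : Submodule ℂ (Fin (n + 1) → ℂ) where
  carrier := {x | ∀ i ∉ T, (S *ᵥ x) i = 0}
  add_mem' := by
    intro x y hx hy i hi
    rw [Matrix.mulVec_add, Pi.add_apply, hx i hi, hy i hi, add_zero]
  zero_mem' := by simp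
  smul_mem' := by
    intro c x hx i hi
    rw [Matrix.mulVec_smul, Pi.smul_apply, hx i hi, smul_zero]

theorem mem_coordSubspace {n : ℕ} {S : Matrix (Fin (n + 1)) (Fin (n + 1)) ℂ}
    {T : Finset (Fin (n + 1))} {x : Fin (n + 1) → ℂ} :
    x ∈ coordSubspace S T ↔ ∀ i ∉ T, (S *ᵥ x) i = 0 :=
  Iff.rfl

/-- Only this inequality is needed: the stability bound weakens as the dimension grows. -/
theorem finrank_coordSubspace_le {n : ℕ} {S : Matrix (Fin (n + 1)) (Fin (n + 1)) ℂ}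
    (hS : S.det ≠ 0) (T : Finset (Fin (n + 1))) :
    Module.finrank ℂ (coordSubspace S T) ≤ T.card := by
  let f : coordSubspace S T →ₗ[ℂ] (T → ℂ) :=
    (LinearMap.funLeft ℂ ℂ (Subtype.val : T → Fin (n + 1))) ∘ₗ S.mulVecLin ∘ₗ
      (coordSubspace S T).subtype
  have hf : Function.Injective f := by
    rw [← LinearMap.ker_eq_bot, LinearMap.ker_eq_bot']
    intro x hx
    have h : S *ᵥ x.1 = 0 := by
      funext i
      by_cases hi : i ∈ T
      · exact congrFun hx ⟨i, hi⟩
      · exact x.2 i hi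
    refine Subtype.ext (Matrix.mulVec_injective_of_isUnit
      ((Matrix.isUnit_iff_isUnit_det S).2 hS.isUnit) ?_)
    simpa using h
  have := LinearMap.finrank_le_finrank_of_injective hf
  simpa using this

theorem inv_mulVec_single_mem_coordSubspace {n : ℕ}
    {S : Matrix (Fin (n + 1)) (Fin (n + 1)) ℂ} (hS : S.det ≠ 0) {T : Finset (Fin (n + 1))}
    {i : Fin (n + 1)} : S⁻¹ *ᵥ Pi.single i 1 ∈ coordSubspace S T ↔ i ∈ T := by
  rw [mem_coordSubspace, Matrix.mulVec_mulVec, Matrix.mul_nonsing_inv S hS.isUnit,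
    Matrix.one_mulVec]
  constructor
  · intro h
    by_contra hi
    simpa using h i hi
  · intro hi k hk
    exact Pi.single_eq_of_ne (fun h : k = i => hk (h ▸ hi)) _

open Classical in
theorem card_coordSubspace_lt {n m : ℕ} {v : CoordTuple n m}
    (hv : (ScaledCluster.mk v).toCluster.IsStable)
    {S : Matrix (Fin (n + 1)) (Fin (n + 1)) ℂ} (hS : S.det ≠ 0) {T : Finset (Fin (n + 1))}
    (hT : T.Nonempty) (hT' : T ≠ Finset.univ) :
    (n + 1) * (Finset.univ.filter fun j => (v j).1 ∈ coordSubspace S T).card < T.card * m := by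
  have h := hv (coordSubspace S T) ?_ ?_
  · rw [degOn_toCluster_mk] at h
    exact h.trans_le (Nat.mul_le_mul_right m (finrank_coordSubspace_le hS T))
  · obtain ⟨i, hi⟩ := hT
    intro h0
    have h1 := (inv_mulVec_single_mem_coordSubspace hS).2 hi
    rw [h0, Submodule.mem_bot] at h1
    exact inv_mulVec_single_ne_zero hS i h1
  · intro h0
    refine hT' (Finset.eq_univ_iff_forall.2 fun i => ?_)
    rw [← inv_mulVec_single_mem_coordSubspace hS, h0]
    exact Submodule.mem_top

/-- The vectors of a stable tuple are not all eigenvectors of a non-scalar diagonalizable map. -/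
theorem exists_const_of_isStable {n m : ℕ} {v : CoordTuple n m}
    (hv : (ScaledCluster.mk v).toCluster.IsStable)
    {S : Matrix (Fin (n + 1)) (Fin (n + 1)) ℂ} (hS : S.det ≠ 0) {d : Fin (n + 1) → ℝ}
    (e : Fin m → ℝ) (he : ∀ j i, (S *ᵥ (v j).1) i ≠ 0 → d i = e j) :
    ∀ i, d i = d 0 := by
  classical
  by_contra! hne
  obtain ⟨i₀, hi₀⟩ := hne
  -- Stability is applied to the eigenspace of each value of `d`. Both the indices `i` and the
  -- points `j` are partitioned by these values, a point having a nonzero coordinate somewhere, so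
  -- the sum of the inequalities is absurd.
  let I : Finset ℝ := Finset.univ.image d
  have hlt : ∀ a ∈ I, (n + 1) * (Finset.univ.filter fun j => e j = a).card <
      (Finset.univ.filter fun i => d i = a).card * m := by
    intro a ha
    obtain ⟨i, -, hi⟩ := Finset.mem_image.1 ha
    refine lt_of_le_of_lt (Nat.mul_le_mul_left _ (Finset.card_le_card ?_))
      (card_coordSubspace_lt hv hS (T := Finset.univ.filter fun i => d i = a)
        ⟨i, by simpa using hi⟩ ?_)
    · intro j hj
      rw [Finset.mem_filter] at hj ⊢
      refine ⟨Finset.mem_univ _, fun i hi => ?_⟩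
      by_contra h
      exact hi (by simpa [he j i h] using hj.2)
    · intro h
      have h1 := fun k => (Finset.mem_filter.1 (Finset.eq_univ_iff_forall.1 h k)).2
      exact hi₀ ((h1 i₀).trans (h1 0).symm)
  have hsum := Finset.sum_lt_sum_of_nonempty ⟨d 0, Finset.mem_image_of_mem d (Finset.mem_univ 0)⟩
    hlt
  have hd : ∑ a ∈ I, (Finset.univ.filter fun i => d i = a).card = n + 1 := by
    rw [← Finset.card_eq_sum_card_image]
    simp
  have he' : ∑ a ∈ I, (Finset.univ.filter fun j => e j = a).card = m := by
    rw [← Finset.card_eq_sum_card_fiberwise]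
    · simp
    · intro j _
      have h : S *ᵥ (v j).1 ≠ 0 := fun h => (v j).2
        (Matrix.mulVec_injective_of_isUnit ((Matrix.isUnit_iff_isUnit_det S).2 hS.isUnit)
          (by simpa using h))
      obtain ⟨i, hi⟩ := Function.ne_iff.1 h
      exact Finset.mem_image.2 ⟨i, Finset.mem_univ _, he j i hi⟩
  rw [← Finset.mul_sum, ← Finset.sum_mul, hd, he'] at hsum
  exact lt_irrefl _ hsum

/-! ### Critical points are global minima -/

/-- Jensen's inequality for the concave logarithm with weights `q i / ∑ q`. It says that `t ↦ log ∑
dᵢᵗ qᵢ` lies above its tangent at 0, evaluated at `t = 1`. Strict concavity forces `d` to be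
constant on the support of `q` in the equality case. -/
theorem sum_mul_log_le_log_sum {ι : Type*} [Fintype ι] {q d : ι → ℝ} (hq : ∀ i, 0 ≤ q i)
    (hQ : 0 < ∑ i, q i) (hd : ∀ i, 0 < d i) :
    (∑ i, Real.log (d i) * q i) / (∑ i, q i) + Real.log (∑ i, q i) ≤
      Real.log (∑ i, d i * q i) ∧
    ((∑ i, Real.log (d i) * q i) / (∑ i, q i) + Real.log (∑ i, q i) =
      Real.log (∑ i, d i * q i) → ∃ c, ∀ i, q i ≠ 0 → d i = c) := by
  set Q := ∑ i, q i with hQdef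
  have hR : 0 < ∑ i, d i * q i := by
    obtain ⟨i, hi, hi'⟩ := Finset.exists_lt_of_sum_lt (s := Finset.univ) (f := fun _ => (0 : ℝ))
      (g := q) (by simpa using hQ)
    exact Finset.sum_pos' (fun i _ => mul_nonneg (hd i).le (hq i)) ⟨i, hi, mul_pos (hd i) hi'⟩
  set R := ∑ i, d i * q i with hRdef
  -- The weighted mean of `d`: the bound `log x ≤ x - 1` at `x = d i / c` has linear terms that
  -- cancel in the weighted sum.
  set c := R / Q with hc
  have hc0 : 0 < c := div_pos hR hQ
  have hlogc : Real.log c = Real.log R - Real.log Q := Real.log_div hR.ne' hQ.ne'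
  have hterm : ∀ i, Real.log (d i) * q i ≤ Real.log c * q i + (d i / c - 1) * q i := by
    intro i
    have h := Real.log_le_sub_one_of_pos (div_pos (hd i) hc0)
    rw [Real.log_div (hd i).ne' hc0.ne'] at h
    nlinarith [mul_le_mul_of_nonneg_right h (hq i)]
  have hrhs : ∑ i, (Real.log c * q i + (d i / c - 1) * q i) = Real.log c * Q := by
    have h1 : ∑ i, (d i / c - 1) * q i = R / c - Q := by
      rw [hRdef, hQdef, Finset.sum_div, ← Finset.sum_sub_distrib]
      exact Finset.sum_congr rfl fun i _ => by ring
    rw [Finset.sum_add_distrib, ← Finset.mul_sum, h1, hc]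
    field_simp
    ring
  have hle : ∑ i, Real.log (d i) * q i ≤ Real.log c * Q :=
    (Finset.sum_le_sum fun i _ => hterm i).trans_eq hrhs
  constructor
  · have := (div_le_iff₀ hQ).2 hle
    linarith
  · intro heq
    refine ⟨c, fun i hi => ?_⟩
    by_contra hne
    have hlt : ∑ i, Real.log (d i) * q i < Real.log c * Q := by
      rw [← hrhs]
      refine Finset.sum_lt_sum (fun i _ => hterm i) ⟨i, Finset.mem_univ i, ?_⟩
      have h := Real.log_lt_sub_one_of_pos (div_pos (hd i) hc0)
        (fun h => hne ((div_eq_one_iff_eq hc0.ne').1 h))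
      rw [Real.log_div (hd i).ne' hc0.ne'] at h
      nlinarith [mul_lt_mul_of_pos_right h ((hq i).lt_of_ne' hi)]
    have := (div_lt_iff₀ hQ).2 hlt
    linarith

/-- The direction `log d` is the initial velocity of the curve `Sᴴ diag(dᵢᵗ) S` from the first form
to the second. A vanishing derivative there combines with Jensen, applied to each point, to give the
inequality; equality holds only if it holds for every point. -/
theorem distOn_diagForm_one_le {n m : ℕ} (v : CoordTuple n m)
    {S : Matrix (Fin (n + 1)) (Fin (n + 1)) ℂ} (hS : S.det ≠ 0) {d : Fin (n + 1) → ℝ}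
    (hd : ∀ i, 0 < d i)
    (hcrit : HasDerivAt (fun t : ℝ => clusterDist (ScaledCluster.mk v)
      (FormSpace.ofMatrix (diagForm S 1 + t • diagForm S fun i => Real.log (d i)))) 0 0) :
    distOn v ⟨diagForm S 1, posDef_diagForm hS fun _ => one_pos⟩ ≤
      distOn v ⟨diagForm S d, posDef_diagForm hS hd⟩ ∧
    (distOn v ⟨diagForm S d, posDef_diagForm hS hd⟩ ≤
      distOn v ⟨diagForm S 1, posDef_diagForm hS fun _ => one_pos⟩ →
      (ScaledCluster.mk v).toCluster.IsStable → ∀ i, d i = d 0) := by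
  have hder := (hasDerivAt_clusterDist v hS fun i => Real.log (d i)).unique hcrit
  have hpos : ∀ j, 0 < ∑ i, ‖(S *ᵥ (v j).1) i‖ ^ 2 := fun j => by
    simpa using sum_norm_sq_mulVec_pos hS (d := 1) (fun _ => one_pos) (v j).2
  have hj := fun j => sum_mul_log_le_log_sum (q := fun i => ‖(S *ᵥ (v j).1) i‖ ^ 2)
    (fun i => sq_nonneg _) (hpos j) hd
  have hsum := Finset.sum_le_sum fun j (_ : j ∈ Finset.univ) => (hj j).1
  rw [Finset.sum_add_distrib] at hsum
  rw [distOn_diagForm v hS hd, distOn_diagForm v hS (d := 1) fun _ => one_pos]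
  simp only [Pi.one_apply, one_mul, Real.log_one, Finset.sum_const_zero, add_zero]
  constructor
  · linarith
  · intro hle hv
    have heq : ∀ j, _ := (Finset.sum_eq_sum_iff_of_le fun j (_ : j ∈ Finset.univ) =>
      (hj j).1).1 (by rw [Finset.sum_add_distrib]; linarith)
    choose e he using fun j => (hj j).2 (heq j (Finset.mem_univ j))
    exact exists_const_of_isStable hv hS e fun j i h => he j i
      (pow_ne_zero 2 (norm_ne_zero_iff.2 h))

/-- Simultaneous diagonalization puts an arbitrary second form on a curve issuing from the critical
one. Stability enters only in the uniqueness clause. -/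
theorem le_and_eq_of_isCriticalPoint {n m : ℕ} {v : CoordTuple n m} {Q : FormSpace ℂ n}
    (hQ : IsCriticalPoint (clusterDist (ScaledCluster.mk v)) Q) (Q' : FormSpace ℂ n) :
    clusterDist (ScaledCluster.mk v) Q ≤ clusterDist (ScaledCluster.mk v) Q' ∧
      (clusterDist (ScaledCluster.mk v) Q' ≤ clusterDist (ScaledCluster.mk v) Q →
        (ScaledCluster.mk v).toCluster.IsStable → Q' = Q) := by
  obtain ⟨⟨A, hA⟩, rfl⟩ := Quotient.exists_rep Q
  obtain ⟨⟨B, hB⟩, rfl⟩ := Quotient.exists_rep Q'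
  obtain ⟨S, hS, d, rfl, rfl⟩ := exists_simultaneous_diagForm hA hB.isHermitian
  have hd := pos_of_posDef_diagForm hS hB
  have hmain := distOn_diagForm_one_le v hS hd
    (hQ ⟨_, hA⟩ rfl _ (isHermitian_diagForm S fun i => Real.log (d i)))
  refine ⟨hmain.1, fun hle hv => ?_⟩
  have hconst := hmain.2 hle hv
  refine (Quotient.sound (s := scalingSetoid ℂ n) ⟨d 0, hd 0, ?_⟩).symm
  change diagForm S d = d 0 • diagForm S 1
  rw [smul_diagForm]
  congr 1
  funext i
  simpa using hconst i

theorem isCriticalPoint_of_forall_le {n m : ℕ} {v : CoordTuple n m} {Q : FormSpace ℂ n}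
    (hQ : ∀ Q', clusterDist (ScaledCluster.mk v) Q ≤ clusterDist (ScaledCluster.mk v) Q') :
    IsCriticalPoint (clusterDist (ScaledCluster.mk v)) Q := by
  rintro ⟨A, hA⟩ rfl B hB
  obtain ⟨S, hS, d, rfl, rfl⟩ := exists_simultaneous_diagForm hA hB
  have h := hasDerivAt_clusterDist v hS d
  have hmin : IsLocalMin (fun t : ℝ => clusterDist (ScaledCluster.mk v)
      (FormSpace.ofMatrix (diagForm S 1 + t • diagForm S d))) 0 := by
    refine Filter.Eventually.of_forall fun t => ?_
    simp only [zero_smul, add_zero]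
    rw [ofMatrix_of_posDef hA]
    exact hQ _
  rwa [hmin.hasDerivAt_eq_zero h] at h

/-! ### Existence of a global minimum -/

theorem isCompact_unitaryGroup (n : ℕ) :
    IsCompact (Matrix.unitaryGroup (Fin (n + 1)) ℂ : Set (Matrix (Fin (n + 1)) (Fin (n + 1)) ℂ)) := by
  have hK : IsCompact (Set.univ.pi fun _ : Fin (n + 1) => Set.univ.pi fun _ : Fin (n + 1) =>
      Metric.closedBall (0 : ℂ) 1) :=
    isCompact_univ_pi fun _ => isCompact_univ_pi fun _ => isCompact_closedBall 0 1
  refine hK.of_isClosed_subset ?_ ?_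
  · have h : (Matrix.unitaryGroup (Fin (n + 1)) ℂ : Set (Matrix (Fin (n + 1)) (Fin (n + 1)) ℂ)) =
        {U | U * star U = 1} := by
      ext U
      exact Matrix.mem_unitaryGroup_iff
    rw [h]
    exact isClosed_eq (by fun_prop) continuous_const
  · intro U hU i _ j _
    rw [mem_closedBall_zero_iff]
    exact entry_norm_bound_of_unitary hU i j

theorem continuous_norm_sq_mulVec {n : ℕ} (P : Fin (n + 1) → ℂ) (i : Fin (n + 1)) :
    Continuous fun U : Matrix (Fin (n + 1)) (Fin (n + 1)) ℂ => ‖(U *ᵥ P) i‖ ^ 2 :=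
  (((continuous_apply i).comp (continuous_id.matrix_mulVec continuous_const)).norm).pow 2

/-- If vectors do not lie on a common subspace spanned by the members of `T` of a unitary basis,
then uniformly so. -/
theorem exists_pos_le_norm_sq_mulVec {n m : ℕ} (v : CoordTuple n m) (T : Finset (Fin (n + 1)))
    (J : Finset (Fin m)) : ∃ c : ℝ, 0 < c ∧
      ((∀ U ∈ Matrix.unitaryGroup (Fin (n + 1)) ℂ, ∃ j ∈ J, (v j).1 ∉ coordSubspace U T) →
        ∀ U ∈ Matrix.unitaryGroup (Fin (n + 1)) ℂ,
          ∃ j ∈ J, ∃ i ∉ T, c ≤ ‖(U *ᵥ (v j).1) i‖ ^ 2) := by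
  -- The constant is chosen before the hypothesis, with a dummy value 1 when that fails, so that a
  -- minimum over all `T` and `J` can be taken afterwards.
  by_cases h : ∀ U ∈ Matrix.unitaryGroup (Fin (n + 1)) ℂ, ∃ j ∈ J, (v j).1 ∉ coordSubspace U T
  swap
  · exact ⟨1, one_pos, fun h' => absurd h' h⟩
  obtain ⟨U₀, hU₀, hmin⟩ := (isCompact_unitaryGroup n).exists_isMinOn ⟨1, one_mem _⟩
    (f := fun U => ∑ j ∈ J, ∑ i ∈ Tᶜ, ‖(U *ᵥ (v j).1) i‖ ^ 2)
    (Continuous.continuousOn (continuous_finsetSum _ fun j _ => continuous_finsetSum _ fun i _ =>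
      continuous_norm_sq_mulVec _ _))
  set δ := ∑ j ∈ J, ∑ i ∈ Tᶜ, ‖(U₀ *ᵥ (v j).1) i‖ ^ 2 with hδ
  have hδ0 : 0 < δ := by
    obtain ⟨j, hj, hj'⟩ := h U₀ hU₀
    rw [mem_coordSubspace] at hj'
    push Not at hj'
    obtain ⟨i, hi, hi'⟩ := hj'
    refine Finset.sum_pos' (fun j _ => Finset.sum_nonneg fun i _ => sq_nonneg _) ⟨j, hj, ?_⟩
    exact Finset.sum_pos' (fun i _ => sq_nonneg _) ⟨i, Finset.mem_compl.2 hi,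
      pow_pos (norm_pos_iff.2 hi') 2⟩
  -- A sum that is at least `δ` has a term at least its average. The extra 1 keeps the denominator
  -- positive and makes the contradiction strict.
  have hN : (0 : ℝ) < J.card * Tᶜ.card + 1 := by positivity
  refine ⟨δ / (J.card * Tᶜ.card + 1), div_pos hδ0 hN, fun _ U hU => ?_⟩
  by_contra! hlt
  have h1 : ∑ j ∈ J, ∑ i ∈ Tᶜ, ‖(U *ᵥ (v j).1) i‖ ^ 2 ≤
      ∑ j ∈ J, ∑ i ∈ Tᶜ, δ / (J.card * Tᶜ.card + 1) :=
    Finset.sum_le_sum fun j hj => Finset.sum_le_sum fun i hi =>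
      (hlt j hj i (Finset.mem_compl.1 hi)).le
  have h2 : δ ≤ ∑ j ∈ J, ∑ i ∈ Tᶜ, ‖(U *ᵥ (v j).1) i‖ ^ 2 := hmin hU
  have h3 := h2.trans h1
  simp only [Finset.sum_const, nsmul_eq_mul] at h3
  rw [← mul_assoc, mul_div_assoc', le_div_iff₀ hN] at h3
  linarith

/-- Uniform version of stability over all unitary bases. -/
theorem exists_uniform_of_isStable {n m : ℕ} {v : CoordTuple n m}
    (hv : (ScaledCluster.mk v).toCluster.IsStable) :
    ∃ c : ℝ, 0 < c ∧ ∀ U ∈ Matrix.unitaryGroup (Fin (n + 1)) ℂ,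
      (∀ j, ∃ i, c ≤ ‖(U *ᵥ (v j).1) i‖ ^ 2) ∧
      ∀ (T : Finset (Fin (n + 1))) (J : Finset (Fin m)), T.Nonempty → T ≠ Finset.univ →
        (∀ j ∈ J, ∀ i ∉ T, ‖(U *ᵥ (v j).1) i‖ ^ 2 < c) → (n + 1) * J.card < T.card * m := by
  choose c hc hcT using exists_pos_le_norm_sq_mulVec v
  obtain ⟨x, -, hx⟩ := Finset.exists_min_image
    (Finset.univ : Finset (Finset (Fin (n + 1)) × Finset (Fin m))) (fun p => c p.1 p.2)
    ⟨(∅, ∅), Finset.mem_univ _⟩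
  have hmin : ∀ T J, c x.1 x.2 ≤ c T J := fun T J => hx (T, J) (Finset.mem_univ _)
  refine ⟨c x.1 x.2, hc _ _, fun U hU => ⟨fun j => ?_, fun T J hT hT' hlt => ?_⟩⟩
  · have hnot : ∀ U ∈ Matrix.unitaryGroup (Fin (n + 1)) ℂ, (v j).1 ∉ coordSubspace U ∅ := by
      intro U hU hj
      refine (v j).2 (Matrix.mulVec_injective_of_isUnit ((Matrix.isUnit_iff_isUnit_det U).2
        (det_ne_zero_of_mem_unitaryGroup hU).isUnit) ?_)
      simp only [Matrix.mulVec_zero]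
      funext i
      exact hj i (Finset.notMem_empty i)
    -- With `T` empty the subspace is zero, so the condition for `{j}` is just that the vector is
    -- nonzero.
    obtain ⟨j', hj', i, -, hi⟩ :=
      hcT ∅ {j} (fun U hU => ⟨j, Finset.mem_singleton_self j, hnot U hU⟩) U hU
    rw [Finset.mem_singleton] at hj'
    subst hj'
    exact ⟨i, (hmin _ _).trans hi⟩
  · classical
    by_contra hge
    obtain ⟨j, hj, i, hi, hle⟩ := hcT T J (fun U' hU' => by
      by_contra! hJ
      refine hge (lt_of_le_of_lt (Nat.mul_le_mul_left _ (Finset.card_le_card fun j hj => ?_))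
        (card_coordSubspace_lt hv (det_ne_zero_of_mem_unitaryGroup hU') hT hT'))
      simpa using hJ j hj) U hU
    exact absurd ((hmin _ _).trans hle) (not_le.2 (hlt j hj i hi))

/-- Telescoping, written over all `k` with an indicator so that the sum over `k` can be interchanged
with sums over indices or points. -/
theorem last_sub_eq_sum {n : ℕ} (l : Fin (n + 1) → ℝ) (i : Fin (n + 1)) :
    l (Fin.last n) - l i =
      ∑ k : Fin n, if i ≤ k.castSucc then l k.succ - l k.castSucc else 0 := by
  induction i using Fin.reverseInduction with
  | last =>
    rw [sub_self, Finset.sum_eq_zero]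
    intro k _
    rw [if_neg (not_le.2 (Fin.castSucc_lt_last k))]
  | cast p ih =>
    have h : ∀ k : Fin n, (if p.castSucc ≤ k.castSucc then l k.succ - l k.castSucc else 0) =
        (if p.succ ≤ k.castSucc then l k.succ - l k.castSucc else 0) +
          if k = p then l k.succ - l k.castSucc else 0 := by
      intro k
      rcases lt_trichotomy k p with hk | hk | hk
      · rw [if_neg (by simpa using hk), if_neg (by rw [Fin.succ_le_castSucc_iff]; exact hk.asymm),
          if_neg hk.ne, add_zero]
      · subst hk
        simp
      · rw [if_pos (by simpa using hk.le), if_pos (by rwa [Fin.succ_le_castSucc_iff]),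
          if_neg hk.ne', add_zero]
    rw [Finset.sum_congr rfl fun k _ => h k, Finset.sum_add_distrib, ← ih]
    simp

/-- Abel summation for a monotone weight against a strictly unbalanced distribution. -/
theorem last_sub_zero_le {n m : ℕ} {l : Fin (n + 1) → ℝ} (hl : Monotone l)
    (e : Fin m → Fin (n + 1))
    (h : ∀ k : Fin n, (n + 1) * (Finset.univ.filter fun j => e j ≤ k.castSucc).card <
      (Finset.Iic k.castSucc).card * m) :
    l (Fin.last n) - l 0 ≤ (n + 1) * ∑ j, l (e j) - m * ∑ i, l i := by
  have h1 : ∑ i, (l (Fin.last n) - l i) = ∑ k : Fin n,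
      ((Finset.Iic k.castSucc).card : ℝ) * (l k.succ - l k.castSucc) := by
    rw [Finset.sum_congr rfl fun i _ => last_sub_eq_sum l i, Finset.sum_comm]
    refine Finset.sum_congr rfl fun k _ => ?_
    rw [← Finset.sum_filter, Finset.sum_const, nsmul_eq_mul]
    congr 3
    ext i
    simp
  have h2 : ∑ j, (l (Fin.last n) - l (e j)) = ∑ k : Fin n,
      ((Finset.univ.filter fun j => e j ≤ k.castSucc).card : ℝ) *
        (l k.succ - l k.castSucc) := by
    rw [Finset.sum_congr rfl fun j _ => last_sub_eq_sum l (e j), Finset.sum_comm]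
    refine Finset.sum_congr rfl fun k _ => ?_
    rw [← Finset.sum_filter, Finset.sum_const, nsmul_eq_mul]
  have h3 : (n + 1) * ∑ j, l (e j) - m * ∑ i, l i =
      m * ∑ i, (l (Fin.last n) - l i) - (n + 1) * ∑ j, (l (Fin.last n) - l (e j)) := by
    simp only [Finset.sum_sub_distrib, Finset.sum_const, Finset.card_univ, Fintype.card_fin,
      nsmul_eq_mul]
    push_cast
    ring
  rw [h3, h1, h2, Finset.mul_sum, Finset.mul_sum, ← Finset.sum_sub_distrib, last_sub_eq_sum l 0]
  refine Finset.sum_le_sum fun k _ => ?_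
  rw [if_pos (Fin.zero_le _)]
  -- A strict inequality of integers has a gap of at least 1; this supplies the coefficient 1 of
  -- each increment of `l`.
  have h4 : ((n : ℝ) + 1) * ((Finset.univ.filter fun j => e j ≤ k.castSucc).card : ℝ) + 1 ≤
      ((Finset.Iic k.castSucc).card : ℝ) * m := by
    exact_mod_cast h k
  have h5 : 0 ≤ l k.succ - l k.castSucc := sub_nonneg.2 (hl (Fin.castSucc_le_succ k))
  nlinarith [mul_le_mul_of_nonneg_right h4 h5]

/-- On stable clusters the distance function controls the ratio of the extreme eigenvalues. -/
theorem exists_le_distOn {n m : ℕ} {v : CoordTuple n m}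
    (hv : (ScaledCluster.mk v).toCluster.IsStable) :
    ∃ C : ℝ, ∀ (U : Matrix (Fin (n + 1)) (Fin (n + 1)) ℂ)
      (hU : U ∈ Matrix.unitaryGroup (Fin (n + 1)) ℂ) (d : Fin (n + 1) → ℝ) (hd : ∀ i, 0 < d i),
      Monotone d → C + (Real.log (d (Fin.last n)) - Real.log (d 0)) / (n + 1) ≤
        distOn v ⟨diagForm U d, posDef_diagForm (det_ne_zero_of_mem_unitaryGroup hU) hd⟩ := by
  obtain ⟨c, hc, hcU⟩ := exists_uniform_of_isStable hv
  refine ⟨m * Real.log c, fun U hU d hd hmono => ?_⟩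
  obtain ⟨hex, hcard⟩ := hcU U hU
  -- `e j` will be the last index whose coordinate reaches the threshold `c`. Points with `e j ≤ k`
  -- are then nearly in the span of the first basis vectors up to `k`, where uniform stability
  -- limits their number.
  have hmax : ∀ j, ∃ i, c ≤ ‖(U *ᵥ (v j).1) i‖ ^ 2 ∧
      ∀ k, c ≤ ‖(U *ᵥ (v j).1) k‖ ^ 2 → k ≤ i := by
    intro j
    obtain ⟨i₀, hi₀⟩ := hex j
    obtain ⟨i, hi, hi'⟩ := Finset.exists_max_image
      (Finset.univ.filter fun i => c ≤ ‖(U *ᵥ (v j).1) i‖ ^ 2) id ⟨i₀, by simpa using hi₀⟩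
    exact ⟨i, (Finset.mem_filter.1 hi).2, fun k hk => hi' k (by simpa using hk)⟩
  choose e he he' using hmax
  have hgap := last_sub_zero_le (l := fun i => Real.log (d i))
    (fun i k hik => Real.log_le_log (hd i) (hmono hik)) e (fun k => by
      refine hcard _ _ ⟨0, by simp⟩ ?_ ?_
      · intro h
        have h1 := Finset.eq_univ_iff_forall.1 h (Fin.last n)
        rw [Finset.mem_Iic] at h1
        exact absurd h1 (not_le.2 (Fin.castSucc_lt_last k))
      · intro j hj i hi
        by_contra! hle
        exact hi (Finset.mem_Iic.2 ((he' j i hle).trans (Finset.mem_filter.1 hj).2)))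
  have hterm : ∀ j, Real.log c + Real.log (d (e j)) ≤
      Real.log (∑ i, d i * ‖(U *ᵥ (v j).1) i‖ ^ 2) := by
    intro j
    rw [add_comm, ← Real.log_mul (hd _).ne' hc.ne']
    refine Real.log_le_log (mul_pos (hd _) hc) ?_
    exact (mul_le_mul_of_nonneg_left (he j) (hd _).le).trans
      (Finset.single_le_sum (f := fun i => d i * ‖(U *ᵥ (v j).1) i‖ ^ 2)
        (fun i _ => mul_nonneg (hd i).le (sq_nonneg _)) (Finset.mem_univ (e j)))
  have hsum := Finset.sum_le_sum fun j (_ : j ∈ Finset.univ) => hterm j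
  rw [Finset.sum_add_distrib, Finset.sum_const, Finset.card_univ, Fintype.card_fin,
    nsmul_eq_mul] at hsum
  have hdet : ‖U.det‖ = 1 := by
    have := (Matrix.det_of_mem_unitary hU)
    exact CStarRing.norm_of_mem_unitary this
  rw [distOn_diagForm v (det_ne_zero_of_mem_unitaryGroup hU) hd, hdet]
  simp only [one_pow, Real.log_one, zero_add]
  have hn : (0 : ℝ) < n + 1 := by positivity
  have h2 : (Real.log (d (Fin.last n)) - Real.log (d 0)) / (n + 1) ≤
      ∑ j, Real.log (d (e j)) - (m : ℝ) / (n + 1) * ∑ i, Real.log (d i) := by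
    rw [div_le_iff₀ hn]
    refine hgap.trans_eq ?_
    field_simp
  linarith

/-- The identity form serves as a competitor: forms with too large an eigenvalue ratio do worse than
it, and the others, normalized to least eigenvalue 1, are parametrized by a compact set. -/
theorem exists_forall_clusterDist_le {n m : ℕ} {v : CoordTuple n m}
    (hv : (ScaledCluster.mk v).toCluster.IsStable) :
    ∃ Q, ∀ Q', clusterDist (ScaledCluster.mk v) Q ≤ clusterDist (ScaledCluster.mk v) Q' := by
  obtain ⟨C, hC⟩ := exists_le_distOn hv
  have h1 : (1 : Matrix (Fin (n + 1)) (Fin (n + 1)) ℂ) ∈ Matrix.unitaryGroup (Fin (n + 1)) ℂ :=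
    one_mem _
  have hn : (0 : ℝ) < n + 1 := by positivity
  set D₁ := distOn v ⟨diagForm 1 1, posDef_diagForm (det_ne_zero_of_mem_unitaryGroup h1)
    fun _ => one_pos⟩ with hD₁
  have hCD : C ≤ D₁ := by
    simpa using hC 1 h1 1 (fun _ => one_pos) monotone_const
  -- Chosen so that the coercive lower bound exceeds `D₁` once the largest normalized eigenvalue
  -- exceeds `R`.
  set R := Real.exp ((n + 1) * (D₁ - C)) with hR
  have hR1 : 1 ≤ R := Real.one_le_exp (mul_nonneg hn.le (sub_nonneg.2 hCD))
  have hpos : ∀ d ∈ Set.univ.pi (fun _ : Fin (n + 1) => Set.Icc (1 : ℝ) R), ∀ i, 0 < d i :=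
    fun d hd i => one_pos.trans_le (hd i trivial).1
  obtain ⟨⟨U₀, d₀⟩, ⟨hU₀, hd₀⟩, hmin⟩ := ((isCompact_unitaryGroup n).prod
    (isCompact_univ_pi fun _ : Fin (n + 1) => isCompact_Icc (a := (1 : ℝ)) (b := R))).exists_isMinOn
    (f := fun p => ∑ j, Real.log (∑ i, p.2 i * ‖(p.1 *ᵥ (v j).1) i‖ ^ 2) -
        (m : ℝ) / (n + 1) * (Real.log (‖p.1.det‖ ^ 2) + ∑ i, Real.log (p.2 i)))
    ⟨(1, 1), h1, fun _ _ => ⟨le_rfl, hR1⟩⟩ (by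
      rintro ⟨U, d⟩ ⟨hU, hd⟩
      refine ContinuousAt.continuousWithinAt ?_
      have hU' := det_ne_zero_of_mem_unitaryGroup hU
      refine ContinuousAt.sub (tendsto_finsetSum _ fun j _ => ContinuousAt.log ?_ ?_)
        (ContinuousAt.mul continuousAt_const (ContinuousAt.add (ContinuousAt.log ?_ ?_)
          (tendsto_finsetSum _ fun i _ => ContinuousAt.log ?_ ?_)))
      · refine Continuous.continuousAt (continuous_finsetSum _ fun i _ => Continuous.mul ?_ ?_)
        · fun_prop
        · exact (continuous_norm_sq_mulVec (v j).1 i).comp continuous_fst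
      · exact (sum_norm_sq_mulVec_pos hU' (hpos d hd) (v j).2).ne'
      · exact (continuous_fst.matrix_det.norm.pow 2).continuousAt
      · exact pow_ne_zero 2 (norm_ne_zero_iff.2 hU')
      · exact Continuous.continuousAt (by fun_prop)
      · exact (hpos d hd i).ne')
  have hle : ∀ U (hU : U ∈ Matrix.unitaryGroup (Fin (n + 1)) ℂ), ∀ d
      (hd : d ∈ Set.univ.pi (fun _ : Fin (n + 1) => Set.Icc (1 : ℝ) R)),
      distOn v ⟨diagForm U₀ d₀, posDef_diagForm (det_ne_zero_of_mem_unitaryGroup hU₀)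
        (hpos d₀ hd₀)⟩ ≤ distOn v ⟨diagForm U d, posDef_diagForm
        (det_ne_zero_of_mem_unitaryGroup hU) (hpos d hd)⟩ := by
    intro U hU d hd
    rw [distOn_diagForm v (det_ne_zero_of_mem_unitaryGroup hU₀) (hpos d₀ hd₀),
      distOn_diagForm v (det_ne_zero_of_mem_unitaryGroup hU) (hpos d hd)]
    exact hmin (show (U, d) ∈ _ from ⟨hU, hd⟩)
  refine ⟨FormSpace.mk ⟨diagForm U₀ d₀, posDef_diagForm (det_ne_zero_of_mem_unitaryGroup hU₀)
        (hpos d₀ hd₀)⟩, fun Q' => ?_⟩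
  obtain ⟨⟨A, hA⟩, rfl⟩ := Quotient.exists_rep Q'
  obtain ⟨U, hU, d, hmono, rfl⟩ := exists_unitary_diagForm hA.isHermitian
  have hdU := det_ne_zero_of_mem_unitaryGroup hU
  have hd := pos_of_posDef_diagForm hdU hA
  have hd0 : 0 < (d 0)⁻¹ := inv_pos.2 (hd 0)
  have hd' : ∀ i, 0 < ((d 0)⁻¹ • d) i := fun i => mul_pos hd0 (hd i)
  have hmono' : Monotone ((d 0)⁻¹ • d) := fun i k hik =>
    mul_le_mul_of_nonneg_left (hmono hik) hd0.le
  have hone : ((d 0)⁻¹ • d) 0 = 1 := inv_mul_cancel₀ (hd 0).ne'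
  have heq : distOn v ⟨diagForm U d, hA⟩ =
      distOn v ⟨diagForm U ((d 0)⁻¹ • d), posDef_diagForm hdU hd'⟩ :=
    distOn_scaling v ⟨(d 0)⁻¹, hd0, (smul_diagForm U d _).symm⟩
  change distOn v _ ≤ distOn v ⟨diagForm U d, hA⟩
  rw [heq]
  by_cases hlast : ((d 0)⁻¹ • d) (Fin.last n) ≤ R
  · exact hle U hU _ fun i _ => ⟨hone.symm.trans_le (hmono' (Fin.zero_le i)),
      (hmono' (Fin.le_last i)).trans hlast⟩
  · have h2 := hC U hU _ hd' hmono'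
    have h3 := (Real.lt_log_iff_exp_lt (hd' _)).2 (not_le.1 hlast)
    rw [hone, Real.log_one, sub_zero] at h2
    have h4 : D₁ - C < Real.log (((d 0)⁻¹ • d) (Fin.last n)) / (n + 1) := by
      rw [lt_div_iff₀ hn, mul_comm]
      exact h3
    have h5 := hle 1 h1 1 fun _ _ => ⟨le_rfl, hR1⟩
    linarith

/-! ### Dependence on the scaling, and the covariant -/

theorem ScaledCluster.exists_mk {n m : ℕ} (Zt : ScaledCluster n m) :
    ∃ v, ScaledCluster.mk v = Zt :=
  Quotient.exists_rep Zt

theorem coe_toCluster_mk {n m : ℕ} (v : CoordTuple n m) :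
    ((ScaledCluster.mk v).toCluster : Multiset (ProjSpace n)) =
      Finset.univ.val.map fun j => Projectivization.mk' ℂ (v j) :=
  rfl

theorem exists_toCluster_eq {n m : ℕ} (Z : Cluster n m) :
    ∃ Zt : ScaledCluster n m, Zt.toCluster = Z := by
  obtain ⟨s, hs⟩ := Z
  induction s using Quotient.inductionOn with
  | h l =>
    subst hs
    refine ⟨ScaledCluster.mk fun j => ⟨(l.get j).rep, Projectivization.rep_nonzero _⟩,
      Subtype.ext ?_⟩
    change Multiset.map (fun j => Projectivization.mk' ℂ (⟨(l.get j).rep, _⟩ :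
      {v : Fin (n + 1) → ℂ // v ≠ 0})) Finset.univ.val = (l : Multiset (ProjSpace n))
    simp only [Projectivization.mk'_eq_mk, Projectivization.mk_rep]
    have h := Fin.univ_val_map (n := l.length) l.get
    rw [List.ofFn_get] at h
    exact h

/-- Replacing each vector by the chosen representative of its point changes the logarithms by
constants independent of the form. What remains depends only on the cluster. -/
theorem exists_distOn_eq {n m : ℕ} (v : CoordTuple n m) :
    ∃ K : ℝ, ∀ A : PDMatrix ℂ n, distOn v A =
      (((ScaledCluster.mk v).toCluster : Multiset (ProjSpace n)).map
        fun P => Real.log (hermValue A.1 P.rep)).sum -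
        (m : ℝ) / (n + 1) * Real.log A.1.det.re + K := by
  have hc : ∀ j, ∃ c : ℂ, c ≠ 0 ∧ c • (Projectivization.mk' ℂ (v j)).rep = (v j).1 := by
    intro j
    obtain ⟨c, hc⟩ := Projectivization.exists_smul_eq_mk_rep ℂ (v j).1 (v j).2
    refine ⟨(c⁻¹ : ℂˣ), (c⁻¹).ne_zero, ?_⟩
    rw [Projectivization.mk'_eq_mk, ← hc]
    exact inv_smul_smul c (v j).1
  choose c hc0 hc using hc
  refine ⟨∑ j, Real.log (‖c j‖ ^ 2), fun A => ?_⟩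
  have h1 : ∀ j, Real.log (hermValue A.1 (v j).1) =
      Real.log (‖c j‖ ^ 2) +
        Real.log (hermValue A.1 (Projectivization.mk' ℂ (v j)).rep) := by
    intro j
    conv_lhs => rw [← hc j, hermValue_smul_right]
    rw [Real.log_mul (pow_ne_zero 2 (norm_ne_zero_iff.2 (hc0 j)))
      (hermValue_pos A.2 (Projectivization.rep_nonzero _)).ne']
  have h2 : (((ScaledCluster.mk v).toCluster : Multiset (ProjSpace n)).map
        fun P => Real.log (hermValue A.1 P.rep)).sum =
      ∑ j, Real.log (hermValue A.1 (Projectivization.mk' ℂ (v j)).rep) := by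
    rw [coe_toCluster_mk, Multiset.map_map]
    rfl
  rw [h2, distOn, Finset.sum_congr rfl fun j _ => h1 j, Finset.sum_add_distrib]
  ring

theorem exists_clusterDist_eq_add {n m : ℕ} {Zt Zt' : ScaledCluster n m}
    (h : Zt.toCluster = Zt'.toCluster) :
    ∃ C : ℝ, ∀ Q, clusterDist Zt Q = clusterDist Zt' Q + C := by
  obtain ⟨v, rfl⟩ := Zt.exists_mk
  obtain ⟨w, rfl⟩ := Zt'.exists_mk
  obtain ⟨K, hK⟩ := exists_distOn_eq v
  obtain ⟨K', hK'⟩ := exists_distOn_eq w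
  refine ⟨K - K', fun Q => ?_⟩
  obtain ⟨A, rfl⟩ := Quotient.exists_rep Q
  change distOn v A = distOn w A + (K - K')
  rw [hK, hK', h]
  ring

theorem isCriticalPoint_clusterDist_iff {n m : ℕ} (Zt : ScaledCluster n m) (Q : FormSpace ℂ n) :
    IsCriticalPoint (clusterDist Zt) Q ↔ ∀ Q', clusterDist Zt Q ≤ clusterDist Zt Q' := by
  obtain ⟨v, rfl⟩ := Zt.exists_mk
  exact ⟨fun h Q' => (le_and_eq_of_isCriticalPoint h Q').1, isCriticalPoint_of_forall_le⟩

/-- The choice defining `z` asks for a point critical for all scalings at once; one exists because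
the distances for two scalings differ by a constant. -/
theorem isCriticalPoint_z {n m : ℕ} {Zt : ScaledCluster n m} (hZ : Zt.toCluster.IsStable) :
    IsCriticalPoint (clusterDist Zt) (z Zt.toCluster) := by
  have h : ∃ Q, ∀ Zt' : ScaledCluster n m, Zt'.toCluster = Zt.toCluster →
      IsCriticalPoint (clusterDist Zt') Q := by
    obtain ⟨v, rfl⟩ := Zt.exists_mk
    obtain ⟨Q, hQ⟩ := exists_forall_clusterDist_le hZ
    refine ⟨Q, fun Zt' h => (isCriticalPoint_clusterDist_iff Zt' Q).2 fun Q' => ?_⟩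
    obtain ⟨C, hC⟩ := exists_clusterDist_eq_add h
    rw [hC, hC]
    exact add_le_add_left (hQ Q') C
  exact Classical.epsilon_spec h Zt rfl

theorem clusterDist_z_le {n m : ℕ} {Zt : ScaledCluster n m} (hZ : Zt.toCluster.IsStable)
    (Q : FormSpace ℂ n) : clusterDist Zt (z Zt.toCluster) ≤ clusterDist Zt Q :=
  (isCriticalPoint_clusterDist_iff Zt _).1 (isCriticalPoint_z hZ) Q

theorem eq_z_of_forall_le {n m : ℕ} {Zt : ScaledCluster n m} (hZ : Zt.toCluster.IsStable)
    {Q : FormSpace ℂ n} (hQ : ∀ Q', clusterDist Zt Q ≤ clusterDist Zt Q') :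
    Q = z Zt.toCluster := by
  have h := isCriticalPoint_z hZ
  obtain ⟨v, rfl⟩ := Zt.exists_mk
  exact (le_and_eq_of_isCriticalPoint h Q).2 (hQ _) hZ

theorem theta_eq_exp {n m : ℕ} {Zt : ScaledCluster n m} (hZ : Zt.toCluster.IsStable) :
    theta Zt = Real.exp (clusterDist Zt (z Zt.toCluster)) := by
  refine le_antisymm (ciInf_le ⟨0, ?_⟩ _) (le_ciInf fun Q => Real.exp_le_exp.2
    (clusterDist_z_le hZ Q))
  rintro _ ⟨Q, rfl⟩
  exact (Real.exp_pos _).le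

/-! ### Transport of stability -/

/-- Stated for semilinear maps so that the group action and complex conjugation are treated
together; rank is invariant under a semilinear bijection over a bijective ring map. -/
theorem finrank_comap_of_bijective {n : ℕ} {σ : ℂ →+* ℂ} (hσ : Function.Bijective σ)
    {f : (Fin (n + 1) → ℂ) →ₛₗ[σ] (Fin (n + 1) → ℂ)} (hf : Function.Bijective f)
    (W : Submodule ℂ (Fin (n + 1) → ℂ)) :
    Module.finrank ℂ (W.comap f) = Module.finrank ℂ W := by
  let g : W.comap f →+ W :=
    { toFun := fun x => ⟨f x.1, x.2⟩
      map_zero' := Subtype.ext (map_zero f)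
      map_add' := fun x y => Subtype.ext (map_add f x.1 y.1) }
  have hg : Function.Bijective g := by
    refine ⟨fun x y h => Subtype.ext (hf.1 (congrArg Subtype.val h)), fun y => ?_⟩
    obtain ⟨x, hx⟩ := hf.2 y.1
    exact ⟨⟨x, by rw [Submodule.mem_comap, hx]; exact y.2⟩, Subtype.ext hx⟩
  have h := rank_eq_of_equiv_equiv σ (AddEquiv.ofBijective g hg) hσ
    (fun r x => Subtype.ext (map_smulₛₗ f r x.1))
  rw [Module.finrank, Module.finrank, h]

theorem degOn_map {n m : ℕ} {σ : ℂ →+* ℂ} {f : (Fin (n + 1) → ℂ) →ₛₗ[σ] (Fin (n + 1) → ℂ)}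
    (hf : Function.Injective f) (Z : Cluster n m) (W : Submodule ℂ (Fin (n + 1) → ℂ)) :
    Cluster.degOn (Sym.map (Projectivization.map f hf) Z) W = Z.degOn (W.comap f) := by
  have h : ∀ P : ProjSpace n,
      (Projectivization.map f hf P).submodule ≤ W ↔ P.submodule ≤ W.comap f := by
    intro P
    induction P using Projectivization.ind with
    | h v hv =>
      rw [Projectivization.map_mk, Projectivization.submodule_mk, Projectivization.submodule_mk,
        Submodule.span_singleton_le_iff_mem, Submodule.span_singleton_le_iff_mem,
        Submodule.mem_comap]
  classical
  change Multiset.card (Multiset.filter _ (Multiset.map _ Z.1)) = Multiset.card (Multiset.filter _ Z.1)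
  rw [Multiset.filter_map, Multiset.card_map]
  congr 1
  exact Multiset.filter_congr fun P _ => h P

theorem isStable_map {n m : ℕ} {σ : ℂ →+* ℂ} (hσ : Function.Bijective σ)
    {f : (Fin (n + 1) → ℂ) →ₛₗ[σ] (Fin (n + 1) → ℂ)} (hf : Function.Bijective f)
    {Z : Cluster n m} (hZ : Z.IsStable) :
    Cluster.IsStable (Sym.map (Projectivization.map f hf.1) Z) := by
  intro W hW hW'
  have hfin := finrank_comap_of_bijective hσ hf W
  rw [degOn_map, ← hfin]
  refine hZ _ (fun h => hW ?_) (fun h => hW' ?_)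
  · rw [h, finrank_bot] at hfin
    exact Submodule.finrank_eq_zero.1 hfin.symm
  · refine Submodule.eq_top_iff'.2 fun y => ?_
    obtain ⟨x, rfl⟩ := hf.2 y
    exact Submodule.mem_comap.1 (h ▸ Submodule.mem_top)

theorem coordAct_bijective {n : ℕ} (γ : Matrix.SpecialLinearGroup (Fin (n + 1)) ℂ) :
    Function.Bijective (coordAct γ) :=
  ⟨coordAct_injective γ, LinearMap.injective_iff_surjective.1 (coordAct_injective γ)⟩

theorem coordConj_bijective (n : ℕ) : Function.Bijective (coordConj n) := by
  refine ⟨coordConj_injective n, fun x => ⟨coordConj n x, ?_⟩⟩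
  funext i
  exact Complex.conj_conj (x i)

theorem isStable_act {n m : ℕ} {Z : Cluster n m} (hZ : Z.IsStable)
    (γ : Matrix.SpecialLinearGroup (Fin (n + 1)) ℂ) : (Z.act γ).IsStable :=
  isStable_map Function.bijective_id (coordAct_bijective γ) hZ

theorem isStable_conj {n m : ℕ} {Z : Cluster n m} (hZ : Z.IsStable) : Z.conj.IsStable :=
  isStable_map (starRingAut (R := ℂ)).bijective (coordConj_bijective n) hZ

/-! ### Equivariance of the distance function -/

theorem toCluster_act {n m : ℕ} (Zt : ScaledCluster n m)
    (γ : Matrix.SpecialLinearGroup (Fin (n + 1)) ℂ) :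
    (Zt.act γ).toCluster = Zt.toCluster.act γ := by
  obtain ⟨v, rfl⟩ := Zt.exists_mk
  exact Subtype.ext (Multiset.map_map (Projectivization.map (coordAct γ) (coordAct_injective γ))
    (fun j => Projectivization.mk' ℂ (v j)) Finset.univ.val).symm

theorem toCluster_conj {n m : ℕ} (Zt : ScaledCluster n m) :
    Zt.conj.toCluster = Zt.toCluster.conj := by
  obtain ⟨v, rfl⟩ := Zt.exists_mk
  exact Subtype.ext (Multiset.map_map (Projectivization.map (coordConj n) (coordConj_injective n))
    (fun j => Projectivization.mk' ℂ (v j)) Finset.univ.val).symm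

theorem hermValue_coordAct {n : ℕ} (A : Matrix (Fin (n + 1)) (Fin (n + 1)) ℂ)
    (γ : Matrix.SpecialLinearGroup (Fin (n + 1)) ℂ) (P : Fin (n + 1) → ℂ) :
    hermValue (γ.1ᴴ * A * γ.1) (coordAct γ P) =
      hermValue A P := by
  have h : γ.1 *ᵥ coordAct γ P = P := by
    change _ *ᵥ (P ᵥ* (_)ᵀ) = P
    rw [Matrix.vecMul_transpose, Matrix.mulVec_mulVec, ← Matrix.SpecialLinearGroup.coe_mul,
      mul_inv_cancel, Matrix.SpecialLinearGroup.coe_one, Matrix.one_mulVec]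
  rw [hermValue, ← Matrix.mulVec_mulVec, ← Matrix.mulVec_mulVec, Matrix.dotProduct_mulVec,
    ← Matrix.star_mulVec, h, hermValue]

theorem clusterDist_act {n m : ℕ} (Zt : ScaledCluster n m)
    (γ : Matrix.SpecialLinearGroup (Fin (n + 1)) ℂ) (Q : FormSpace ℂ n) :
    clusterDist (Zt.act γ) (Q.act γ) = clusterDist Zt Q := by
  obtain ⟨v, rfl⟩ := Zt.exists_mk
  obtain ⟨A, rfl⟩ := Quotient.exists_rep Q
  change ∑ j, Real.log (hermValue (γ.1ᴴ * A.1 * γ.1)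
      (coordAct γ (v j).1)) - (m : ℝ) / (n + 1) *
      Real.log (γ.1ᴴ * A.1 * γ.1).det.re = distOn v A
  have hdet : (γ.1ᴴ * A.1 * γ.1).det = A.1.det := by
    rw [Matrix.det_mul, Matrix.det_mul, Matrix.det_conjTranspose, γ.det_coe]
    simp
  simp only [hermValue_coordAct, hdet]
  rfl

theorem hermValue_conj {n : ℕ} (A : Matrix (Fin (n + 1)) (Fin (n + 1)) ℂ)
    (P : Fin (n + 1) → ℂ) :
    hermValue (A.map (starRingEnd ℂ)) (coordConj n P) = hermValue A P := by
  have h : star (coordConj n P) ⬝ᵥ A.map (starRingEnd ℂ) *ᵥ coordConj n P =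
      starRingEnd ℂ (star P ⬝ᵥ A *ᵥ P) := by
    simp [dotProduct, Matrix.mulVec, map_sum, coordConj]
  rw [hermValue, h, Complex.conj_re, hermValue]

theorem clusterDist_conj {n m : ℕ} (Zt : ScaledCluster n m) (Q : FormSpace ℂ n) :
    clusterDist Zt.conj Q.conj = clusterDist Zt Q := by
  obtain ⟨v, rfl⟩ := Zt.exists_mk
  obtain ⟨A, rfl⟩ := Quotient.exists_rep Q
  change ∑ j, Real.log (hermValue (A.1.map (starRingEnd ℂ)) (coordConj n (v j).1)) -
      (m : ℝ) / (n + 1) * Real.log (A.1.map (starRingEnd ℂ)).det.re = distOn v A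
  have hdet : (A.1.map (starRingEnd ℂ)).det.re = A.1.det.re := by
    have h := RingHom.map_det (starRingEnd ℂ) A.1
    rw [RingHom.mapMatrix_apply] at h
    rw [← h, Complex.conj_re]
  simp only [hermValue_conj, hdet]
  rfl

theorem FormSpace.act_surjective {n : ℕ} (γ : Matrix.SpecialLinearGroup (Fin (n + 1)) ℂ) :
    Function.Surjective fun Q : FormSpace ℂ n => Q.act γ := by
  intro Q
  refine ⟨Q.act γ⁻¹, ?_⟩
  obtain ⟨A, rfl⟩ := Quotient.exists_rep Q
  refine congrArg (Quotient.mk _) (Subtype.ext ?_)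
  change γ.1ᴴ * ((γ⁻¹).1ᴴ * A.1 * (γ⁻¹).1) * γ.1 = A.1
  have h : (γ⁻¹).1 * γ.1 = 1 := by
    rw [← Matrix.SpecialLinearGroup.coe_mul, inv_mul_cancel, Matrix.SpecialLinearGroup.coe_one]
  rw [Matrix.mul_assoc, Matrix.mul_assoc, h, Matrix.mul_one, ← Matrix.mul_assoc,
    ← Matrix.conjTranspose_mul, h, Matrix.conjTranspose_one, Matrix.one_mul]

theorem FormSpace.conj_conj {n : ℕ} (Q : FormSpace ℂ n) : Q.conj.conj = Q := by
  obtain ⟨A, rfl⟩ := Quotient.exists_rep Q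
  refine congrArg (Quotient.mk _) (Subtype.ext (Matrix.ext fun i j => ?_))
  exact Complex.conj_conj (A.1 i j)

/-- The distance is invariant and the action on forms is surjective, so the translate of the minimum
is a minimum for the translated cluster; uniqueness identifies it. -/
theorem z_act {n m : ℕ} {Z : Cluster n m} (hZ : Z.IsStable)
    (γ : Matrix.SpecialLinearGroup (Fin (n + 1)) ℂ) : z (Z.act γ) = (z Z).act γ := by
  obtain ⟨Zt, rfl⟩ := exists_toCluster_eq Z
  have hst := isStable_act hZ γ
  rw [← toCluster_act] at hst ⊢
  refine (eq_z_of_forall_le hst fun Q' => ?_).symm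
  obtain ⟨Q, rfl⟩ := FormSpace.act_surjective γ Q'
  rw [clusterDist_act, clusterDist_act]
  exact clusterDist_z_le hZ Q

theorem z_conj {n m : ℕ} {Z : Cluster n m} (hZ : Z.IsStable) : z Z.conj = (z Z).conj := by
  obtain ⟨Zt, rfl⟩ := exists_toCluster_eq Z
  have hst := isStable_conj hZ
  rw [← toCluster_conj] at hst ⊢
  refine (eq_z_of_forall_le hst fun Q' => ?_).symm
  rw [← Q'.conj_conj, clusterDist_conj, clusterDist_conj]
  exact clusterDist_z_le hZ _

theorem theta_act {n m : ℕ} (Zt : ScaledCluster n m)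
    (γ : Matrix.SpecialLinearGroup (Fin (n + 1)) ℂ) : theta (Zt.act γ) = theta Zt :=
  ((FormSpace.act_surjective γ).iInf_congr _ fun Q => by rw [clusterDist_act]).symm

theorem theta_conj {n m : ℕ} (Zt : ScaledCluster n m) : theta Zt.conj = theta Zt :=
  (Function.Surjective.iInf_congr FormSpace.conj (fun Q => ⟨Q.conj, Q.conj_conj⟩)
    fun Q => by rw [clusterDist_conj]).symm

/-! ### Real forms -/

theorem FormSpace.complexify_injective {n : ℕ} :
    Function.Injective (FormSpace.complexify (n := n)) := by
  intro p q h
  obtain ⟨A, rfl⟩ := Quotient.exists_rep p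
  obtain ⟨B, rfl⟩ := Quotient.exists_rep q
  obtain ⟨c, hc, h⟩ := Quotient.exact (s := scalingSetoid ℂ n) h
  refine Quotient.sound (s := scalingSetoid ℝ n) ⟨c, hc, Matrix.ext fun i j => ?_⟩
  have hij : ((B.1 i j : ℝ) : ℂ) = c • ((A.1 i j : ℝ) : ℂ) := congrFun (congrFun h i) j
  rw [Complex.real_smul] at hij
  exact_mod_cast hij

/-- A representative equals its conjugate only up to a positive factor. Its diagonal entries are
real and positive, which forces the factor to be 1 and every entry to be real. -/
theorem FormSpace.exists_complexify_eq {n : ℕ} {Q : FormSpace ℂ n} (hQ : Q.conj = Q) :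
    ∃ q : FormSpace ℝ n, q.complexify = Q := by
  obtain ⟨⟨A, hA⟩, rfl⟩ := Quotient.exists_rep Q
  obtain ⟨c, hc, h⟩ := Quotient.exact (s := scalingSetoid ℂ n) hQ
  have hij : ∀ i j, A i j = c * starRingEnd ℂ (A i j) := fun i j => by
    have := congrFun (congrFun h i) j
    simpa using this
  have hc1 : c = 1 := by
    have h0 := hA.diag_pos (i := 0)
    have h1 := congrArg Complex.re (hij 0 0)
    rw [Complex.re_ofReal_mul, Complex.conj_re] at h1
    have h2 := (Complex.pos_iff.1 h0).1
    exact (mul_right_cancel₀ h2.ne' ((one_mul _).trans h1)).symm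
  subst hc1
  have hreal : ∀ i j, ((A i j).re : ℂ) = A i j := fun i j =>
    Complex.conj_eq_iff_re.1 (by simpa using (hij i j).symm)
  have hmap : (A.map Complex.re).map (algebraMap ℝ ℂ) = A := by
    ext i j
    exact hreal i j
  have hpos : (A.map Complex.re).PosDef := by
    refine Matrix.PosDef.of_dotProduct_mulVec_pos ?_ fun x hx => ?_
    · ext i j
      have := congrArg Complex.re (hA.isHermitian.apply i j)
      simpa using this
    · have hx' : (fun i => (x i : ℂ)) ≠ 0 := fun h0 => hx (by
        funext i
        exact Complex.ofReal_eq_zero.1 (congrFun h0 i))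
      have h1 := hermValue_pos hA hx'
      have h2 : hermValue A (fun i => (x i : ℂ)) = star x ⬝ᵥ A.map Complex.re *ᵥ x := by
        simp [hermValue, dotProduct, Matrix.mulVec]
      rwa [h2] at h1
  refine ⟨FormSpace.mk ⟨A.map Complex.re, hpos⟩, ?_⟩
  exact congrArg (Quotient.mk _) (Subtype.ext hmap)

end PointCluster

theorem mainTheorem4 (n m : ℕ) :
    -- `z` is well defined on stable clusters: the unique critical point, and global minimum
    (∀ Zt : PointCluster.ScaledCluster n m, Zt.toCluster.IsStable →
      (∀ Q : PointCluster.FormSpace ℂ n,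
        PointCluster.IsCriticalPoint (PointCluster.clusterDist Zt) Q ↔
          Q = PointCluster.z Zt.toCluster) ∧
      (∀ Q : PointCluster.FormSpace ℂ n,
        PointCluster.clusterDist Zt (PointCluster.z Zt.toCluster) ≤ PointCluster.clusterDist Zt Q) ∧
      PointCluster.theta Zt =
        Real.exp (PointCluster.clusterDist Zt (PointCluster.z Zt.toCluster))) ∧
    -- equivariance under `SL(n+1, ℂ)`
    (∀ Z : PointCluster.Cluster n m, Z.IsStable →
      ∀ γ : Matrix.SpecialLinearGroup (Fin (n + 1)) ℂ,
        (Z.act γ).IsStable ∧ PointCluster.z (Z.act γ) = (PointCluster.z Z).act γ) ∧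
    -- compatibility with complex conjugation
    (∀ Z : PointCluster.Cluster n m, Z.IsStable →
      Z.conj.IsStable ∧ PointCluster.z Z.conj = (PointCluster.z Z).conj) ∧
    -- restriction to real stable clusters
    (∀ Z : PointCluster.Cluster n m, Z.IsStable → Z.conj = Z →
      ∃! q : PointCluster.FormSpace ℝ n, q.complexify = PointCluster.z Z) ∧
    -- invariance of `θ` on all clusters with scaling
    (∀ (Zt : PointCluster.ScaledCluster n m)
      (γ : Matrix.SpecialLinearGroup (Fin (n + 1)) ℂ),
        PointCluster.theta (Zt.act γ) = PointCluster.theta Zt) ∧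
    (∀ Zt : PointCluster.ScaledCluster n m,
      PointCluster.theta Zt.conj = PointCluster.theta Zt) := by
  refine ⟨fun Zt hZ => ⟨fun Q => ⟨fun hQ => ?_, ?_⟩, PointCluster.clusterDist_z_le hZ,
      PointCluster.theta_eq_exp hZ⟩,
    fun Z hZ γ => ⟨PointCluster.isStable_act hZ γ, PointCluster.z_act hZ γ⟩,
    fun Z hZ => ⟨PointCluster.isStable_conj hZ, PointCluster.z_conj hZ⟩,
    fun Z hZ hconj => ?_, PointCluster.theta_act, PointCluster.theta_conj⟩
  · exact PointCluster.eq_z_of_forall_le hZ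
      ((PointCluster.isCriticalPoint_clusterDist_iff Zt Q).1 hQ)
  · rintro rfl
    exact PointCluster.isCriticalPoint_z hZ
  · have h := PointCluster.z_conj hZ
    rw [hconj] at h
    obtain ⟨q, hq⟩ := PointCluster.FormSpace.exists_complexify_eq h.symm
    exact ⟨q, hq, fun p hp => PointCluster.FormSpace.complexify_injective (hp.trans hq.symm)⟩
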